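/- For integers $l\ge 0$, $s_1,\dots,s_l\ge 1$, $r_1,\dots,r_l\ge 0$ define the bi-bracket of weight $s_1+\dots+s_l+r_1+\dots+r_l$ by $$\begin{bmatrix}s_1,\dots,s_l\\ r_1,\dots,r_l\end{bmatrix}=\sum_{\substack{u_1>\dots>u_l>0\\ v_1,\dots,v_l>0}}\ \prod_{j=1}^{l}\frac{u_j^{r_j}}{r_j!}\,\frac{v_j^{s_j-1}}{(s_j-1)!}\; q^{u_1v_1+\dots+u_lv_l}\in\mathbb Q[[q]]$$ (equal to $1$ for $l=0$). It is called positive if $s_j>r_j$ for all $j$. It is called a bracket, written $[s_1,\dots,s_l]$, if $r_1=\dots=r_l=0$, and a 123-bracket if moreover $s_1,\dots,s_l\in\{1,2,3\}$. Let $\mathcal Z_q\subseteq\mathbb Q[[q]]$ be the $\mathbb Q$-span of all series $$\zeta_q(s_1,\dots,s_l;Q_1,\dots,Q_l)=\sum_{n_1>\dots>n_l>0}\ \prod_{j=1}^{l}\frac{Q_j(q^{n_j})}{(1-q^{n_j})^{s_j}}$$ with $l\ge 0$, $s_j\ge 1$, $Q_j\in\mathbb Q[t]$, $\deg Q_j\le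 s_j$ and $Q_1\in t\,\mathbb Q[t]$ (the series is $1$ for $l=0$), and let $\mathcal Z_q^{\circ}\subseteq\mathcal Z_q$ be the span of those with all $Q_j\in t\,\mathbb Q[t]$. For a subset $A\subseteq\mathcal Z_q$ let $\operatorname{Fil}^{W}_k(A)$ be the $\mathbb Q$-span of the bi-brackets of weight at most $k$ that lie in $A$, with $\operatorname{Fil}^W_{-1}(A)=0$, and let $\operatorname{gr}^W_k(A)=\operatorname{Fil}^W_k(A)/\operatorname{Fil}^W_{k-1}(A)$. **Theorem.** Let $0\le k\le 7$. Then: 1. $\dim_{\mathbb Q}\operatorname{gr}^W_k(\mathcal Z_q)$ is the coefficient of $x^k$ in the power series expansion of $$\frac{1}{1-x-x^2-x^3+x^6+x^7+x^8+x^9}.$$ 2. Every bi-bracket of weight $k$ is a $\mathbb Q$-linear combination of positive bi-brackets of weight at most $k$, a $\mathbb Q$-linear combination of brackets of weight at most $k$, and a $\mathbb Q$-linear combination of 123-brackets of weight at most $k$. Moreover, $\operatorname{Fil}^W_k(\mathcal Z_q^{\circ})=\operatorname{Fil}^W_k(\mathcal Z_q)$. -/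

import Mathlib

namespace QMZV

open PowerSeries

noncomputable section

/-- The pairs `(u, v)` with `u_1 > ⋯ > u_l > 0`, `v_1, …, v_l > 0` and
`u_1 v_1 + ⋯ + u_l v_l = n`. There are finitely many of them, as all entries are at most `n`;
see `mem_biIndex`. -/
def biIndex (l n : ℕ) : Finset ((Fin l → ℕ) × (Fin l → ℕ)) :=
  ((Fintype.piFinset fun _ => Finset.range (n + 1)) ×ˢ
    (Fintype.piFinset fun _ => Finset.range (n + 1))).filter fun p =>
      StrictAnti p.1 ∧ (∀ j, 0 < p.1 j) ∧ (∀ j, 0 < p.2 j) ∧ ∑ j, p.1 j * p.2 j = n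

/-- The bounds in the definition of `biIndex` are no restriction. -/
theorem mem_biIndex {l n : ℕ} (p : (Fin l → ℕ) × (Fin l → ℕ)) :
    p ∈ biIndex l n ↔
      StrictAnti p.1 ∧ (∀ j, 0 < p.1 j) ∧ (∀ j, 0 < p.2 j) ∧ ∑ j, p.1 j * p.2 j = n := by
  simp only [biIndex, Finset.mem_filter, Finset.mem_product, Fintype.mem_piFinset,
    Finset.mem_range, and_iff_right_iff_imp]
  rintro ⟨_, hu, hv, hn⟩
  have key : ∀ j, p.1 j * p.2 j ≤ n := fun j => by
    rw [← hn]
    exact Finset.single_le_sum (f := fun j => p.1 j * p.2 j) (fun _ _ => Nat.zero_le _)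
      (Finset.mem_univ j)
  exact ⟨fun j => Nat.lt_succ_of_le ((Nat.le_mul_of_pos_right _ (hv j)).trans (key j)),
    fun j => Nat.lt_succ_of_le ((Nat.le_mul_of_pos_left _ (hu j)).trans (key j))⟩

/-- The bi-bracket with upper row `s` and lower row `r`, a power series in `q` over `ℚ`:
the sum over `u_1 > ⋯ > u_l > 0` and `v_1, …, v_l > 0` of
`∏ j, (u_j ^ r_j / r_j!) * (v_j ^ (s_j - 1) / (s_j - 1)!) * q ^ (u_1 v_1 + ⋯ + u_l v_l)`.
It is only used for `s_j ≥ 1`. -/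
def biBracket {l : ℕ} (s r : Fin l → ℕ) : PowerSeries ℚ :=
  PowerSeries.mk fun n => ∑ p ∈ biIndex l n,
    ∏ j, ((p.1 j : ℚ) ^ r j / ((r j).factorial : ℚ)) *
      ((p.2 j : ℚ) ^ (s j - 1) / ((s j - 1).factorial : ℚ))

/-- The bracket `[s_1, …, s_l]`. -/
def bracket {l : ℕ} (s : Fin l → ℕ) : PowerSeries ℚ := biBracket s fun _ => 0

/-- The weight `s_1 + ⋯ + s_l + r_1 + ⋯ + r_l`. -/
def weight {l : ℕ} (s r : Fin l → ℕ) : ℕ := ∑ j, s j + ∑ j, r j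

/-- The summand `∏ j, Q_j(q ^ n_j) / (1 - q ^ n_j) ^ s_j`. -/
def zetaTerm {l : ℕ} (s : Fin l → ℕ) (Q : Fin l → Polynomial ℚ) (n : Fin l → ℕ) :
    PowerSeries ℚ :=
  ∏ j, Polynomial.aeval ((X : PowerSeries ℚ) ^ n j) (Q j) *
    (((1 : PowerSeries ℚ) - X ^ n j)⁻¹) ^ s j

/-- The tuples `N ≥ n_1 > ⋯ > n_l > 0`. -/
def decTuples (l N : ℕ) : Finset (Fin l → ℕ) :=
  (Fintype.piFinset fun _ => Finset.range (N + 1)).filter fun n =>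
    StrictAnti n ∧ ∀ j, 0 < n j

/-- `ζ_q(s_1, …, s_l; Q_1, …, Q_l)`, the sum of `zetaTerm s Q n` over all
`n_1 > ⋯ > n_l > 0`. It is only used when `Q_1` has no constant term; then the summand has no
term in degrees below `n_1` (see `coeff_zetaTerm_eq_zero`), so that only the tuples with
`n_1 ≤ N` contribute to the coefficient of `q ^ N`. -/
def zetaQ {l : ℕ} (s : Fin l → ℕ) (Q : Fin l → Polynomial ℚ) : PowerSeries ℚ :=
  PowerSeries.mk fun N => ∑ n ∈ decTuples l N, PowerSeries.coeff N (zetaTerm s Q n)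

theorem coeff_zetaTerm_eq_zero {l : ℕ} (s : Fin l → ℕ) (Q : Fin l → Polynomial ℚ)
    (n : Fin l → ℕ) (i : Fin l) (hQ : (Q i).coeff 0 = 0) {N : ℕ} (hN : N < n i) :
    PowerSeries.coeff N (zetaTerm s Q n) = 0 := by
  have h1 : (X : PowerSeries ℚ) ^ n i ∣ Polynomial.aeval ((X : PowerSeries ℚ) ^ n i) (Q i) := by
    obtain ⟨R, hR⟩ := Polynomial.X_dvd_iff.2 hQ
    rw [hR, map_mul, Polynomial.aeval_X]
    exact dvd_mul_right _ _
  have h2 : (X : PowerSeries ℚ) ^ n i ∣ zetaTerm s Q n :=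
    (h1.mul_right _).trans (Finset.dvd_prod_of_mem
      (fun j => Polynomial.aeval ((X : PowerSeries ℚ) ^ n j) (Q j) *
        (((1 : PowerSeries ℚ) - X ^ n j)⁻¹) ^ s j) (Finset.mem_univ i))
  exact PowerSeries.X_pow_dvd_iff.1 h2 N hN

/-- The space `Z_q`. -/
def Zq : Submodule ℚ (PowerSeries ℚ) :=
  Submodule.span ℚ {f | ∃ (l : ℕ) (s : Fin l → ℕ) (Q : Fin l → Polynomial ℚ),
    (∀ j, 1 ≤ s j) ∧ (∀ j, (Q j).natDegree ≤ s j) ∧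
    (∀ j : Fin l, (j : ℕ) = 0 → (Q j).coeff 0 = 0) ∧ f = zetaQ s Q}

/-- The space `Z_q°`: no polynomial `Q_j` has a constant term. -/
def ZqCirc : Submodule ℚ (PowerSeries ℚ) :=
  Submodule.span ℚ {f | ∃ (l : ℕ) (s : Fin l → ℕ) (Q : Fin l → Polynomial ℚ),
    (∀ j, 1 ≤ s j) ∧ (∀ j, (Q j).natDegree ≤ s j) ∧
    (∀ j, (Q j).coeff 0 = 0) ∧ f = zetaQ s Q}

/-- The weight filtration `Fil^W_k(A)`, spanned by the bi-brackets in `A` of weight at most `k`.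
The index is an integer, so that `Fil^W_{-1}(A) = 0`. -/
def filW (A : Set (PowerSeries ℚ)) (k : ℤ) : Submodule ℚ (PowerSeries ℚ) :=
  Submodule.span ℚ {f | f ∈ A ∧ ∃ (l : ℕ) (s r : Fin l → ℕ),
    (∀ j, 1 ≤ s j) ∧ (l : ℤ) ≤ k ∧ (weight s r : ℤ) ≤ k ∧ f = biBracket s r}

/-- The graded piece `gr^W_k(A) = Fil^W_k(A) / Fil^W_{k-1}(A)`. -/
abbrev grW (A : Set (PowerSeries ℚ)) (k : ℤ) : Type :=
  filW A k ⧸ (filW A (k - 1)).submoduleOf (filW A k)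

/-- The span of the positive bi-brackets (`s_j > r_j` for all `j`) of weight at most `k`. -/
def positiveSpan (k : ℕ) : Submodule ℚ (PowerSeries ℚ) :=
  Submodule.span ℚ {f | ∃ (l : ℕ) (s r : Fin l → ℕ),
    (∀ j, r j < s j) ∧ weight s r ≤ k ∧ f = biBracket s r}

/-- The span of the brackets of weight at most `k`. -/
def bracketSpan (k : ℕ) : Submodule ℚ (PowerSeries ℚ) :=
  Submodule.span ℚ {f | ∃ (l : ℕ) (s : Fin l → ℕ),
    (∀ j, 1 ≤ s j) ∧ ∑ j, s j ≤ k ∧ f = bracket s}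

/-- The span of the 123-brackets (all `s_j ∈ {1, 2, 3}`) of weight at most `k`. -/
def bracketSpan123 (k : ℕ) : Submodule ℚ (PowerSeries ℚ) :=
  Submodule.span ℚ {f | ∃ (l : ℕ) (s : Fin l → ℕ),
    (∀ j, s j = 1 ∨ s j = 2 ∨ s j = 3) ∧ ∑ j, s j ≤ k ∧ f = bracket s}

end

end QMZV

/-!
The letters `(m, r)` of a word stand for the columns `(s, r)` of a bi-bracket with `s = m + 1`, and
`biSpan k` is the span of the bi-brackets of weight less than `k`, so that the filtration step `k`
is `biSpan (k + 1)`. The proof bounds the dimensions of the graded pieces from above and the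
dimension of the whole space in weight at most `7` from below, and the two bounds agree.

Upper bound. Bi-brackets satisfy two families of relations. Modulo lower weight, a product of two
bi-brackets is given by a stuffle product (`biSeries_mul`), because the product of the divided power
series `∑ v ^ a / a! * q ^ v` and `∑ v ^ b / b! * q ^ v` is the one for `a + b + 1` up to terms of
lower order (`powSeries_mul`). Conjugation of partitions, where `u` is the tuple of parts and `v`
that of their multiplicities, expresses every bi-bracket by others of the same weight
(`biSeries_eq_sum_dual`). The products of duality relations with bi-brackets of weight at most `3`
are linear relations between bi-brackets of weight `k` modulo lower weight, with integer
coefficients. Elimination over `𝔽₃` shows for `k ≤ 7` that modulo `3` they express everything by the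
123-brackets of weight `k`, apart from four exceptional ones in weights `6` and `7`
(`check_eq_true`). By Nakayama's lemma, this implies the same over `ℚ` (`biSeries_mem_of_check`).
So bi-brackets are combinations of 123-brackets, and the graded pieces have at most the dimensions
`1, 1, 2, 4, 7, 13, 23, 41`.

Lower bound. These numbers add up to `92`. Multiplied by factorials, the 123-brackets have integer
coefficients, and elimination over `𝔽₃` on the coefficients up to `q ^ 92` finds `92` combinations
with different leading terms modulo `3` (`checkRank_eq_true`). A triangular determinant is then
nonzero modulo `3`, and the space of bi-brackets of weight at most `7` has dimension at least `92`
(`le_finrank_biSpan`).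

Finally, 123-brackets lie in `ZqCirc`, because `∑ v ^ m / m! * q ^ v` is a quotient of a polynomial
in `q * ℚ[q]` by `(1 - q) ^ (m + 1)` (`dilate_eq`). Hence both filtrations are given by all
bi-brackets.

The two eliminations are evaluated by the kernel. The functions that perform them are in
continuation passing style, with results in `Bool`, so that evaluation proceeds strictly and with
vectors in the form of numerals.
-/

namespace QMZV

open PowerSeries

noncomputable section

/-! ### Ternary rows and elimination -/

/-- Passes `n` to `f`, but only after `n` has been evaluated to a numeral: kernel evaluation is
lazy, and without this an argument that is used several times is recomputed several times. -/
def force (n : ℕ) (f : ℕ → Bool) : Bool := Nat.casesOn n (f 0) fun k => f (Nat.succ k)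

@[simp]
theorem force_eq (n : ℕ) (f : ℕ → Bool) : force n f = f n := by cases n <;> rfl

/-- A vector over `𝔽₃` is stored as two bit vectors: `a` marks the entries `1` and `b` marks the
entries `-1`. This is the entry at position `i`. -/
def entry (a b i : ℕ) : ℤ := (a.testBit i).toInt - (b.testBit i).toInt

/-- No position is marked both as `1` and as `-1`. -/
def Reduced (a b : ℕ) : Prop := ∀ i, ¬(a.testBit i = true ∧ b.testBit i = true)

/-- The entries `1` of the sum of the vectors `(a, b)` and `(c, d)`. -/
def sumPos (a b c d : ℕ) : ℕ := Nat.xor (Nat.lor b d) (Nat.xor (Nat.lor a d) (Nat.lor b c))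

/-- The entries `-1` of the sum of the vectors `(a, b)` and `(c, d)`. -/
def sumNeg (a b c d : ℕ) : ℕ := Nat.xor (Nat.lor a c) (Nat.xor (Nat.lor a d) (Nat.lor b c))

theorem testBit_sumPos (a b c d i : ℕ) : (sumPos a b c d).testBit i =
    ((b.testBit i || d.testBit i) ^^ ((a.testBit i || d.testBit i) ^^
      (b.testBit i || c.testBit i))) := by
  change (HXor.hXor (HOr.hOr b d) (HXor.hXor (HOr.hOr a d) (HOr.hOr b c))).testBit i = _
  simp only [Nat.testBit_xor, Nat.testBit_or]

theorem testBit_sumNeg (a b c d i : ℕ) : (sumNeg a b c d).testBit i =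
    ((a.testBit i || c.testBit i) ^^ ((a.testBit i || d.testBit i) ^^
      (b.testBit i || c.testBit i))) := by
  change (HXor.hXor (HOr.hOr a c) (HXor.hXor (HOr.hOr a d) (HOr.hOr b c))).testBit i = _
  simp only [Nat.testBit_xor, Nat.testBit_or]

theorem Reduced.sum {a b c d : ℕ} (h : Reduced a b) (h' : Reduced c d) :
    Reduced (sumPos a b c d) (sumNeg a b c d) := by
  intro i
  have h := h i
  have h' := h' i
  rw [testBit_sumPos, testBit_sumNeg]
  generalize a.testBit i = p at *
  generalize b.testBit i = q at *
  generalize c.testBit i = r at *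
  generalize d.testBit i = s at *
  revert p q r s
  decide

theorem entry_sum {a b c d : ℕ} (h : Reduced a b) (h' : Reduced c d) (i : ℕ) :
    entry (sumPos a b c d) (sumNeg a b c d) i ≡ entry a b i + entry c d i [ZMOD 3] := by
  have h := h i
  have h' := h' i
  simp only [entry]
  rw [testBit_sumPos, testBit_sumNeg]
  generalize a.testBit i = p at *
  generalize b.testBit i = q at *
  generalize c.testBit i = r at *
  generalize d.testBit i = s at *
  revert p q r s
  decide

theorem Reduced.symm {a b : ℕ} (h : Reduced a b) : Reduced b a := fun i hi => h i hi.symm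

theorem reduced_zero (a : ℕ) : Reduced a 0 := by intro i; simp

theorem entry_swap (a b i : ℕ) : entry b a i = -entry a b i := by simp [entry]

/-- Passes the sum of the vectors `(a, b)` and `(c, d)` to `f`. -/
def addRow (a b c d : ℕ) (f : ℕ → ℕ → Bool) : Bool :=
  force (Nat.xor (Nat.lor a d) (Nat.lor b c)) fun t =>
    force (Nat.xor (Nat.lor b d) t) fun p => force (Nat.xor (Nat.lor a c) t) fun q => f p q

theorem addRow_eq (a b c d : ℕ) (f : ℕ → ℕ → Bool) :
    addRow a b c d f = f (sumPos a b c d) (sumNeg a b c d) := by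
  simp only [addRow, force_eq]; rfl

/-- A set of pivot rows, stored in a binary tree: the path to a row spells the binary digits of the
position of its highest nonzero entry. -/
inductive PivotTree
  | empty
  | pivot (a b : ℕ)
  | node (l r : PivotTree)

/-- All rows in the tree satisfy `P`. -/
def PivotTree.All (P : ℕ → ℕ → Prop) : PivotTree → Prop
  | .empty => True
  | .pivot a b => P a b
  | .node l r => l.All P ∧ r.All P

/-- The binary digits of a position, from the top. -/
def shifts : List ℕ := [1024, 512, 256, 128, 64, 32, 16, 8, 4, 2, 1]

/-- Searches the pivot whose highest entry is at the same position as that of the nonzero row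
`(a, b)`, where `n = a ||| b`. If there is none, then the row becomes a pivot and the new tree is
passed to `f`; otherwise the row is cleared at this position, and the result is passed to `g`. -/
def insertReduce (n a b : ℕ) :
    List ℕ → PivotTree → ℕ → (PivotTree → Bool) → (ℕ → ℕ → Bool) → Bool
  | [], .pivot c d, _, _, g =>
    bif Nat.ble (Nat.xor a c) (Nat.xor a d) then addRow a b d c g else addRow a b c d g
  | [], _, _, f, _ => f (.pivot a b)
  | s :: S, .node l r, j, f, g =>
    force (Nat.add j s) fun j' =>
      bif Nat.ble (Nat.shiftLeft 1 j') n then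
        insertReduce n a b S r j' (fun r => f (.node l r)) g
      else insertReduce n a b S l j (fun l => f (.node l r)) g
  | s :: S, _, j, f, g =>
    force (Nat.add j s) fun j' =>
      bif Nat.ble (Nat.shiftLeft 1 j') n then
        insertReduce n a b S .empty j' (fun r => f (.node .empty r)) g
      else insertReduce n a b S .empty j (fun l => f (.node l .empty)) g

/-- Reduces the row `(a, b)` by the pivots in `t`, adds what is left to the pivots, and passes the
new tree to `f`. Only the entries at positions `≥ 64` are reduced. Every step lowers the highest
nonzero position; should the bound on the number of steps be too small, the row is dropped. -/
def insertRow (t : PivotTree) (f : PivotTree → Bool) : ℕ → ℕ → ℕ → Bool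
  | 0, _, _ => f t
  | fuel + 1, a, b => force (Nat.lor a b) fun n =>
    bif Nat.beq (Nat.shiftRight n 64) 0 then f t
    else insertReduce n a b shifts t 0 f (insertRow t f fuel)

/-- Sets of vectors over `𝔽₃` that are closed under addition and negation. -/
structure IsRowSpace (P : ℕ → ℕ → Prop) : Prop where
  sum : ∀ {a b c d}, P a b → P c d → P (sumPos a b c d) (sumNeg a b c d)
  swap : ∀ {a b}, P a b → P b a

theorem insertReduce_spec {P : ℕ → ℕ → Prop} (hP : IsRowSpace P) {n a b : ℕ} (hab : P a b)
    {g : ℕ → ℕ → Bool} : ∀ {S : List ℕ} {t : PivotTree} {j : ℕ} {f : PivotTree → Bool},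
    t.All P → insertReduce n a b S t j f g = true →
      (∃ t' : PivotTree, t'.All P ∧ f t' = true) ∨ ∃ a' b', P a' b' ∧ g a' b' = true
  | [], .pivot c d, _, _, ht, h => by
    rw [insertReduce, Bool.cond_eq_ite] at h
    split_ifs at h <;> rw [addRow_eq] at h
    · exact .inr ⟨_, _, hP.sum hab (hP.swap ht), h⟩
    · exact .inr ⟨_, _, hP.sum hab ht, h⟩
  | [], .empty, _, _, _, h => .inl ⟨.pivot a b, hab, h⟩
  | [], .node _ _, _, _, _, h => .inl ⟨.pivot a b, hab, h⟩
  | s :: S, .node l r, j, f, ht, h => by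
    rw [insertReduce, force_eq, Bool.cond_eq_ite] at h
    split_ifs at h
    · exact (insertReduce_spec hP hab ht.2 h).imp_left fun ⟨t, h, h'⟩ => ⟨.node l t, ⟨ht.1, h⟩, h'⟩
    · exact (insertReduce_spec hP hab ht.1 h).imp_left fun ⟨t, h, h'⟩ => ⟨.node t r, ⟨h, ht.2⟩, h'⟩
  | s :: S, .empty, j, f, ht, h => by
    rw [insertReduce, force_eq, Bool.cond_eq_ite] at h
    · split_ifs at h
      · exact (insertReduce_spec hP hab (t := .empty) trivial h).imp_left
          fun ⟨t, h, h'⟩ => ⟨.node .empty t, ⟨trivial, h⟩, h'⟩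
      · exact (insertReduce_spec hP hab (t := .empty) trivial h).imp_left
          fun ⟨t, h, h'⟩ => ⟨.node t .empty, ⟨h, trivial⟩, h'⟩
    · simp
  | s :: S, .pivot _ _, j, f, ht, h => by
    rw [insertReduce, force_eq, Bool.cond_eq_ite] at h
    · split_ifs at h
      · exact (insertReduce_spec hP hab (t := .empty) trivial h).imp_left
          fun ⟨t, h, h'⟩ => ⟨.node .empty t, ⟨trivial, h⟩, h'⟩
      · exact (insertReduce_spec hP hab (t := .empty) trivial h).imp_left
          fun ⟨t, h, h'⟩ => ⟨.node t .empty, ⟨h, trivial⟩, h'⟩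
    · simp

theorem insertRow_spec {P : ℕ → ℕ → Prop} (hP : IsRowSpace P) {t : PivotTree}
    {f : PivotTree → Bool} (ht : t.All P) : ∀ {fuel a b : ℕ}, P a b →
    insertRow t f fuel a b = true → ∃ t' : PivotTree, t'.All P ∧ f t' = true
  | 0, _, _, _, h => ⟨t, ht, h⟩
  | fuel + 1, a, b, hab, h => by
    rw [insertRow, force_eq, Bool.cond_eq_ite] at h
    split_ifs at h
    · exact ⟨t, ht, h⟩
    · rcases insertReduce_spec hP hab ht h with h | ⟨a', b', hab', h⟩
      · exact h
      · exact insertRow_spec hP ht hab' h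

/-- Whether the tree has a pivot whose highest entry is at position `i`. Here `j` is the part of `i`
that is still to be spelled. -/
def hasPivot (i : ℕ) : List ℕ → ℕ → PivotTree → Bool
  | [], _, .pivot a b => Nat.beq (Nat.shiftRight (Nat.lor a b) i) 1
  | s :: S, j, .node l r => bif Nat.ble s j then hasPivot i S (Nat.sub j s) r else hasPivot i S j l
  | _, _, _ => false

theorem hasPivot_spec {P : ℕ → ℕ → Prop} (hP : ∀ {a b}, P a b → Reduced a b) {i : ℕ} :
    ∀ {S : List ℕ} {j : ℕ} {t : PivotTree}, t.All P → hasPivot i S j t = true →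
      ∃ a b, P a b ∧ (entry a b i = 1 ∨ entry a b i = -1) ∧ ∀ j, i < j → entry a b j = 0
  | [], _, .pivot a b, ht, h => by
    have h : (a ||| b) >>> i = 1 := Nat.eq_of_beq_eq_true h
    have key : ∀ j, (a.testBit (i + j) || b.testBit (i + j)) = decide (j = 0) := by
      intro j
      rw [← Nat.testBit_or, ← Nat.testBit_shiftRight, h]
      simpa [Nat.lt_one_iff] using Nat.testBit_two_pow_sub_one 1 j
    refine ⟨a, b, ht, ?_, fun j hj => ?_⟩
    · have h0 := key 0
      have h1 := hP ht i
      rw [Nat.add_zero] at h0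
      simp only [entry]
      cases ha : a.testBit i <;> cases hb : b.testBit i <;> simp_all
    · have h0 := key (j - i)
      rw [Nat.add_sub_cancel' hj.le] at h0
      have : j - i ≠ 0 := Nat.sub_ne_zero_of_lt hj
      simp only [this, decide_false, Bool.or_eq_false_iff] at h0
      simp [entry, h0.1, h0.2]
  | s :: S, j, .node l r, ht, h => by
    rw [hasPivot, Bool.cond_eq_ite] at h
    split_ifs at h
    · exact hasPivot_spec hP ht.2 h
    · exact hasPivot_spec hP ht.1 h
  | [], _, .empty, _, h => by simp [hasPivot] at h
  | [], _, .node _ _, _, h => by simp [hasPivot] at h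
  | _ :: _, _, .empty, _, h => by simp [hasPivot] at h
  | _ :: _, _, .pivot _ _, _, h => by simp [hasPivot] at h

/-! ### Words and their codes -/

/-- A letter `(m, r)` stands for the column `(s, r)` of a bi-bracket with `s = m + 1`. -/
abbrev Word := List (ℕ × ℕ)

/-- The weight of the bi-bracket that belongs to a word. -/
def wt : Word → ℕ
  | [] => 0
  | x :: w => x.1 + x.2 + 1 + wt w

@[simp] theorem wt_nil : wt [] = 0 := rfl

@[simp] theorem wt_cons (x : ℕ × ℕ) (w : Word) : wt (x :: w) = x.1 + x.2 + 1 + wt w := rfl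

@[simp]
theorem wt_append (v w : Word) : wt (v ++ w) = wt v + wt w := by
  induction v with
  | nil => simp
  | cons x v ih => simp [ih, Nat.add_assoc]

/-- The words of weight `k`. Each is obtained from a word of weight `k - 1` by a change of the
first letter, or by a new first letter. -/
def words : ℕ → List Word
  | 0 => [[]]
  | k + 1 => (words k).flatMap fun w => ((0, 0) :: w) ::
      match w with
      | [] => []
      | (m, 0) :: w => [(m, 1) :: w, (m + 1, 0) :: w]
      | (m, r + 1) :: w => [(m, r + 2) :: w]

theorem mem_words {k : ℕ} {w : Word} : w ∈ words k ↔ wt w = k := by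
  induction k generalizing w with
  | zero =>
    rcases w with _ | ⟨x, w⟩
    · simp [words]
    · simp [words]
  | succ k ih =>
    simp only [words, List.mem_flatMap, ih]
    constructor
    · rintro ⟨v, hv, hw⟩
      rcases v with _ | ⟨⟨m, _ | r⟩, v⟩ <;> simp at hw hv
      · subst hw; subst hv; rfl
      · rcases hw with rfl | rfl | rfl <;> simp <;> omega
      · rcases hw with rfl | rfl <;> simp <;> omega
    · intro hw
      rcases w with _ | ⟨⟨_ | m, _ | _ | r⟩, v⟩ <;> simp at hw
      · exact ⟨v, by omega, by simp⟩
      · exact ⟨(0, 0) :: v, by simp; omega, by simp⟩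
      · exact ⟨(0, r + 1) :: v, by simp; omega, by simp⟩
      · exact ⟨(m, 0) :: v, by simp; omega, by simp⟩
      · exact ⟨(m + 1, 0) :: v, by simp; omega, by simp⟩
      · exact ⟨(m + 1, r + 1) :: v, by simp; omega, by simp⟩

/-- Appends the ternary digits of a letter, which are `1`, then `m` times `0`, then `r` times `2`,
to the number `c`. -/
def letterCode (x : ℕ × ℕ) (c : ℕ) : ℕ :=
  Nat.add (Nat.mul (Nat.pow 3 (Nat.add x.1 x.2)) (Nat.succ (Nat.mul 3 c)))
    (Nat.sub (Nat.pow 3 x.2) 1)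

/-- Appends the ternary digits of all letters of a word to the number `c`. -/
def codeFrom : ℕ → Word → ℕ
  | c, [] => c
  | c, x :: w => codeFrom (letterCode x c) w

/-- The number whose ternary digits are those of the letters of the word. -/
def code (w : Word) : ℕ := codeFrom 0 w

theorem codeFrom_append (c : ℕ) (v w : Word) : codeFrom c (v ++ w) = codeFrom (codeFrom c v) w := by
  induction v generalizing c with
  | nil => rfl
  | cons x v ih => exact ih _

theorem letterCode_succ (x : ℕ × ℕ) (c : ℕ) :
    letterCode x c + 1 = 3 ^ x.2 * (3 ^ x.1 * (3 * c + 1) + 1) := by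
  have h : 1 ≤ 3 ^ x.2 := Nat.one_le_pow _ _ (by norm_num)
  change 3 ^ (x.1 + x.2) * (3 * c + 1) + (3 ^ x.2 - 1) + 1 = _
  rw [add_assoc, Nat.sub_add_cancel h]
  ring

theorem three_pow_mul_inj {i j a b : ℕ} (ha : ¬3 ∣ a) (hb : ¬3 ∣ b)
    (h : 3 ^ i * a = 3 ^ j * b) : i = j ∧ a = b := by
  have key : ∀ {i j a b : ℕ}, ¬3 ∣ a → 3 ^ i * a = 3 ^ j * b → j ≤ i := by
    intro i j a b ha h
    have : 3 ^ j ∣ 3 ^ i * a := h ▸ dvd_mul_right _ _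
    exact (Nat.pow_dvd_pow_iff_le_right (by norm_num)).1
      ((Nat.Coprime.pow_left j
        ((Nat.Prime.coprime_iff_not_dvd Nat.prime_three).2 ha)).dvd_of_dvd_mul_right this)
  have hij : i = j := le_antisymm (key hb h.symm) (key ha h)
  subst hij
  exact ⟨rfl, Nat.eq_of_mul_eq_mul_left (by positivity) h⟩

theorem letterCode_inj {x y : ℕ × ℕ} {c d : ℕ} (h : letterCode x c = letterCode y d) :
    x = y ∧ c = d := by
  have h1 : 3 ^ x.2 * (3 ^ x.1 * (3 * c + 1) + 1) = 3 ^ y.2 * (3 ^ y.1 * (3 * d + 1) + 1) := by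
    rw [← letterCode_succ, ← letterCode_succ, h]
  have hdvd : ∀ m c : ℕ, ¬3 ∣ 3 ^ m * (3 * c + 1) + 1 := by
    intro m c
    rcases m with _ | m
    · omega
    · rw [pow_succ', mul_assoc]; omega
  obtain ⟨h2, h3⟩ := three_pow_mul_inj (hdvd _ _) (hdvd _ _) h1
  obtain ⟨h4, h5⟩ := three_pow_mul_inj (by omega) (by omega) (Nat.add_right_cancel h3)
  exact ⟨Prod.ext h4 h2, by omega⟩

theorem letterCode_pos (x : ℕ × ℕ) (c : ℕ) : letterCode x c ≠ 0 := by
  intro h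
  have h1 := letterCode_succ x c
  have : 0 < 3 ^ x.1 * (3 * c + 1) := by positivity
  have h2 : 1 ≤ 3 ^ x.2 := Nat.one_le_pow _ _ (by norm_num)
  nlinarith

theorem code_injective : Function.Injective code := by
  intro v
  induction v using List.reverseRecOn with
  | nil =>
    intro w h
    induction w using List.reverseRecOn with
    | nil => rfl
    | append_singleton w y _ =>
      rw [code, code, codeFrom_append] at h
      exact absurd h.symm (letterCode_pos _ _)
  | append_singleton v x ih =>
    intro w h
    induction w using List.reverseRecOn with
    | nil =>
      rw [code, code, codeFrom_append] at h
      exact absurd h (letterCode_pos _ _)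
    | append_singleton w y _ =>
      rw [code, code, codeFrom_append, codeFrom_append] at h
      obtain ⟨h₁, h₂⟩ := letterCode_inj (x := x) (y := y) (c := code v) (d := code w) h
      rw [ih h₂, h₁]

/-! ### The leading part of the stuffle product -/

/-- The sum of `y w` over the words `w` of the stuffle product of `a` and `b`, where the stuffle of
two letters is replaced by its part of highest weight. -/
def stuffleSum {M : Type*} [AddCommMonoid M] (y : Word → M) : Word → Word → M
  | [], b => y b
  | x :: a, [] => y (x :: a)
  | x :: a, x' :: b =>
    stuffleSum (fun w => y (x :: w)) a (x' :: b) + stuffleSum (fun w => y (x' :: w)) (x :: a) b +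
      (x.2 + x'.2).choose x.2 •
        stuffleSum (fun w => y ((x.1 + x'.1 + 1, x.2 + x'.2) :: w)) a b
  termination_by a b => a.length + b.length

@[simp]
theorem stuffleSum_nil_left {M : Type*} [AddCommMonoid M] (y : Word → M) (b : Word) :
    stuffleSum y [] b = y b := by rw [stuffleSum]

@[simp]
theorem stuffleSum_nil_right {M : Type*} [AddCommMonoid M] (y : Word → M) (a : Word) :
    stuffleSum y a [] = y a := by cases a <;> rw [stuffleSum]

theorem stuffleSum_cons_cons {M : Type*} [AddCommMonoid M] (y : Word → M) (x x' : ℕ × ℕ)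
    (a b : Word) : stuffleSum y (x :: a) (x' :: b) =
    stuffleSum (fun w => y (x :: w)) a (x' :: b) + stuffleSum (fun w => y (x' :: w)) (x :: a) b +
      (x.2 + x'.2).choose x.2 •
        stuffleSum (fun w => y ((x.1 + x'.1 + 1, x.2 + x'.2) :: w)) a b := by
  rw [stuffleSum]

theorem map_stuffleSum {M N : Type*} [AddCommMonoid M] [AddCommMonoid N] (φ : M →+ N) :
    ∀ (y : Word → M) (a b : Word), φ (stuffleSum y a b) = stuffleSum (fun w => φ (y w)) a b
  | y, [], b => by simp
  | y, x :: a, [] => by simp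
  | y, x :: a, x' :: b => by
    rw [stuffleSum_cons_cons, stuffleSum_cons_cons, map_add, map_add, map_nsmul,
      map_stuffleSum φ _ a (x' :: b), map_stuffleSum φ _ (x :: a) b, map_stuffleSum φ _ a b]
  termination_by _ a b => a.length + b.length

theorem stuffleSum_mem {M : Type*} [AddCommMonoid M] {N : AddSubmonoid M} :
    ∀ (y : Word → M) (a b : Word), (∀ w, wt w = wt a + wt b → y w ∈ N) → stuffleSum y a b ∈ N
  | y, [], b, h => by simpa using h b
  | y, x :: a, [], h => by simpa using h (x :: a)
  | y, x :: a, x' :: b, h => by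
    rw [stuffleSum_cons_cons]
    refine N.add_mem (N.add_mem ?_ ?_) (N.nsmul_mem ?_ _) <;> refine stuffleSum_mem _ _ _ ?_ <;>
      intro w hw <;> apply h <;> simp at hw ⊢ <;> omega
  termination_by _ a b => a.length + b.length

/-! ### Relation rows -/

/-- The vector with entry `1` at position `64 + i`. The positions below `64` only serve as a
checksum of the others, and they are never read: the hash function that the kernel uses for its
caches sees only the lowest `64` bits of a numeral. -/
def unitRow (i : ℕ) : ℕ :=
  Nat.lor (Nat.shiftLeft 1 (Nat.add 64 i)) (Nat.shiftLeft 1 (Nat.mod i 61))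

theorem testBit_unitRow (i j : ℕ) : (unitRow i).testBit (64 + j) = decide (i = j) := by
  change (HOr.hOr (1 <<< (64 + i)) (1 <<< (i % 61))).testBit (64 + j) = _
  have h1 : (1 : ℕ) <<< (i % 61) = 2 ^ (i % 61) := by rw [Nat.shiftLeft_eq, one_mul]
  have h2 : (1 : ℕ) <<< (64 + i) = 2 ^ (64 + i) := by rw [Nat.shiftLeft_eq, one_mul]
  have h3 : i % 61 ≠ 64 + j := by omega
  rw [Nat.testBit_or, h1, h2, Nat.testBit_two_pow, Nat.testBit_two_pow]
  simp [h3]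

/-- Adds `c` times the `i`-th unit vector to the vector `(a, b)`. -/
def addTerm (c i a b : ℕ) (f : ℕ → ℕ → Bool) : Bool :=
  force (unitRow i) fun i =>
    bif Nat.beq (Nat.mod c 3) 1 then addRow a b i 0 f
    else bif Nat.beq (Nat.mod c 3) 2 then addRow a b 0 i f
    else f a b

/-- The step of `addStuffle` for a word `x :: a` and a second word, where `F` stands for
`addStuffle a`. -/
def addStuffleAux (x : ℕ × ℕ) (a : Word)
    (F : Word → ℕ → ℕ → ℕ → ℕ → (ℕ → ℕ → Bool) → Bool) :
    Word → ℕ → ℕ → ℕ → ℕ → (ℕ → ℕ → Bool) → Bool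
  | [], c, e, A, B, f => addTerm c (codeFrom e (x :: a)) A B f
  | y :: b, c, e, A, B, f =>
    force (letterCode x e) fun e₁ => F (y :: b) c e₁ A B fun A B =>
      force (letterCode y e) fun e₂ => addStuffleAux x a F b c e₂ A B fun A B =>
        force (Nat.mod (Nat.mul c (Nat.choose (Nat.add x.2 y.2) x.2)) 3) fun c' =>
          bif Nat.beq c' 0 then f A B
          else force (letterCode (Nat.succ (Nat.add x.1 y.1), Nat.add x.2 y.2) e) fun e₃ =>
            F b c' e₃ A B f

/-- Adds `c` times the leading part of the stuffle product of two words to the vector `(A, B)`,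
where the word `w` has the coordinate with number `codeFrom e w`. -/
def addStuffle : Word → Word → ℕ → ℕ → ℕ → ℕ → (ℕ → ℕ → Bool) → Bool
  | [], b, c, e, A, B, f => addTerm c (codeFrom e b) A B f
  | x :: a, b, c, e, A, B, f => addStuffleAux x a (fun b => addStuffle a b) b c e A B f

/-- Adds the leading parts of the stuffle products of `b` with the words of a formal sum. -/
def addStuffleSum (b : Word) : List (ℤ × Word) → ℕ → ℕ → (ℕ → ℕ → Bool) → Bool
  | [], A, B, f => f A B
  | x :: s, A, B, f =>
    force (Int.toNat (Int.emod x.1 3)) fun c =>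
      addStuffle x.2 b c 0 A B fun A B => addStuffleSum b s A B f

section Evaluation

variable {Q : Type*} [AddCommGroup Q] (y : Word → Q) (k : ℕ)

/-- The value of a vector whose coordinates belong to the words `w` of weight `k`, when the basis
vector of `w` has the value `y w`. -/
def eval (a b : ℕ) : Q := ∑ w ∈ (words k).toFinset, entry a b (64 + code w) • y w

variable {y k}

theorem zsmul_eq_of_modEq {q : Q} (hq : (3 : ℤ) • q = 0) {m n : ℤ} (h : m ≡ n [ZMOD 3]) :
    m • q = n • q := by
  obtain ⟨c, hc⟩ := h.symm.dvd
  rw [← sub_eq_zero, ← sub_smul, hc, mul_comm, mul_smul, hq, smul_zero]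

theorem eval_sum (hy : ∀ w, wt w = k → (3 : ℤ) • y w = 0) {a b c d : ℕ} (h : Reduced a b)
    (h' : Reduced c d) :
    eval y k (sumPos a b c d) (sumNeg a b c d) = eval y k a b + eval y k c d := by
  rw [eval, eval, eval, ← Finset.sum_add_distrib]
  refine Finset.sum_congr rfl fun w hw => ?_
  rw [← add_smul]
  exact zsmul_eq_of_modEq (hy w (mem_words.1 (List.mem_toFinset.1 hw))) (entry_sum h h' _)

theorem eval_swap (a b : ℕ) : eval y k b a = -eval y k a b := by
  simp [eval, entry_swap a b]

theorem eval_unitRow {w : Word} (hw : wt w = k) : eval y k (unitRow (code w)) 0 = y w := by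
  rw [eval, Finset.sum_eq_single w]
  · simp [entry, testBit_unitRow]
  · intro v _ hv
    have : code w ≠ code v := fun h => hv (code_injective h).symm
    simp [entry, testBit_unitRow, this]
  · intro h
    exact absurd (List.mem_toFinset.2 (mem_words.2 hw)) h

theorem eval_zero : eval y k 0 0 = 0 := by simp [eval, entry]

theorem addTerm_spec (hy : ∀ w, wt w = k → (3 : ℤ) • y w = 0) {c : ℕ} {w : Word} (hw : wt w = k)
    {A B : ℕ} {f : ℕ → ℕ → Bool} (hAB : Reduced A B) (h : addTerm c (code w) A B f = true) :
    ∃ A' B', Reduced A' B' ∧ eval y k A' B' = eval y k A B + c • y w ∧ f A' B' = true := by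
  have hc : ∀ n : ℤ, (c : ℤ) ≡ n [ZMOD 3] → c • y w = n • y w := fun n hn => by
    rw [← zsmul_eq_of_modEq (hy w hw) hn, natCast_zsmul]
  rw [addTerm, force_eq, Bool.cond_eq_ite, Bool.cond_eq_ite] at h
  split_ifs at h with h1 h2
  · rw [addRow_eq] at h
    refine ⟨_, _, hAB.sum (reduced_zero _), ?_, h⟩
    have h1 : c % 3 = 1 := Nat.eq_of_beq_eq_true h1
    rw [eval_sum hy hAB (reduced_zero _), eval_unitRow hw, hc 1 (by unfold Int.ModEq; omega),
      one_smul]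
  · rw [addRow_eq] at h
    refine ⟨_, _, hAB.sum (reduced_zero _).symm, ?_, h⟩
    have h2 : c % 3 = 2 := Nat.eq_of_beq_eq_true h2
    rw [eval_sum hy hAB (reduced_zero _).symm, eval_swap (unitRow _), eval_unitRow hw,
      hc (-1) (by unfold Int.ModEq; omega), neg_smul, one_smul]
  · refine ⟨_, _, hAB, ?_, h⟩
    have h1 : c % 3 ≠ 1 := fun h => h1 (by rw [show Nat.mod c 3 = 1 from h]; rfl)
    have h2 : c % 3 ≠ 2 := fun h => h2 (by rw [show Nat.mod c 3 = 2 from h]; rfl)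
    rw [hc 0 (by unfold Int.ModEq; omega), zero_smul, add_zero]

theorem addStuffle_spec (hy : ∀ w, wt w = k → (3 : ℤ) • y w = 0) (p a b : Word) :
    ∀ {c A B : ℕ} {f : ℕ → ℕ → Bool}, wt p + wt a + wt b = k → Reduced A B →
      addStuffle a b c (code p) A B f = true →
      ∃ A' B', Reduced A' B' ∧
        eval y k A' B' = eval y k A B + c • stuffleSum (fun w => y (p ++ w)) a b ∧
        f A' B' = true := by
  have hcode : ∀ (p : Word) (x : ℕ × ℕ), letterCode x (code p) = code (p ++ [x]) := fun p x => by
    rw [code, code, codeFrom_append]; rfl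
  have hfun : ∀ (p : Word) (x : ℕ × ℕ),
      (fun w => y (p ++ [x] ++ w)) = fun w => y (p ++ x :: w) := by simp
  induction a generalizing p b with
  | nil =>
    intro c A B f hk hAB h
    rw [addStuffle, code, ← codeFrom_append] at h
    rw [stuffleSum_nil_left]
    exact addTerm_spec hy (by simpa using hk) hAB h
  | cons x a iha =>
    induction b generalizing p with
    | nil =>
      intro c A B f hk hAB h
      rw [addStuffle, addStuffleAux, code, ← codeFrom_append] at h
      rw [stuffleSum_nil_right]
      exact addTerm_spec hy (by simpa [Nat.add_assoc] using hk) hAB h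
    | cons x' b ihb =>
      intro c A B f hk hAB h
      simp only [wt_cons] at hk
      rw [addStuffle, addStuffleAux] at h
      simp only [force_eq] at h
      rw [hcode] at h
      obtain ⟨A₁, B₁, hAB₁, he₁, h⟩ := iha _ _ (by simp; omega) hAB h
      rw [hcode] at h
      obtain ⟨A₂, B₂, hAB₂, he₂, h⟩ := ihb (p ++ [x']) (by simp; omega) hAB₁
        (by rw [addStuffle]; exact h)
      rw [hfun] at he₁ he₂
      have hc : (c * (x.2 + x'.2).choose x.2 : ℕ) •
          stuffleSum (fun w => y (p ++ (x.1 + x'.1 + 1, x.2 + x'.2) :: w)) a b =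
          (c * (x.2 + x'.2).choose x.2 % 3 : ℕ) •
            stuffleSum (fun w => y (p ++ (x.1 + x'.1 + 1, x.2 + x'.2) :: w)) a b := by
        rw [← natCast_zsmul, ← natCast_zsmul]
        apply zsmul_eq_of_modEq
        · let K : AddSubgroup Q := (zsmulAddGroupHom (3 : ℤ)).ker
          refine stuffleSum_mem (N := K.toAddSubmonoid) _ _ _ fun w hw => ?_
          exact hy _ (by simp; omega)
        · unfold Int.ModEq; omega
      rw [stuffleSum_cons_cons, smul_add, smul_add, smul_smul, hc]
      rw [Bool.cond_eq_ite] at h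
      split_ifs at h with h0
      · have h0 : c * (x.2 + x'.2).choose x.2 % 3 = 0 := Nat.eq_of_beq_eq_true h0
        exact ⟨A₂, B₂, hAB₂, by rw [he₂, he₁, h0, zero_smul, add_zero, add_assoc], h⟩
      · rw [hcode] at h
        obtain ⟨A₃, B₃, hAB₃, he₃, h⟩ := iha _ _ (by simp; omega) hAB₂ h
        refine ⟨A₃, B₃, hAB₃, ?_, h⟩
        rw [hfun] at he₃
        rw [he₃, he₂, he₁, add_assoc, add_assoc, add_assoc]
        rfl

theorem addStuffleSum_spec (hy : ∀ w, wt w = k → (3 : ℤ) • y w = 0) (b : Word)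
    (s : List (ℤ × Word)) : ∀ {A B : ℕ} {f : ℕ → ℕ → Bool}, (∀ x ∈ s, wt x.2 + wt b = k) →
      Reduced A B → addStuffleSum b s A B f = true →
      ∃ A' B', Reduced A' B' ∧
        eval y k A' B' = eval y k A B + (s.map fun x => x.1 • stuffleSum y x.2 b).sum ∧
        f A' B' = true := by
  induction s with
  | nil =>
    intro A B f _ hAB h
    exact ⟨A, B, hAB, by simp, h⟩
  | cons x s ih =>
    intro A B f hs hAB h
    rw [addStuffleSum, force_eq] at h
    have hx := hs x List.mem_cons_self
    obtain ⟨A₁, B₁, hAB₁, he₁, h⟩ := addStuffle_spec hy [] x.2 b (by simpa using hx) hAB h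
    obtain ⟨A₂, B₂, hAB₂, he₂, h⟩ := ih (fun x hx => hs x (List.mem_cons_of_mem _ hx)) hAB₁ h
    refine ⟨A₂, B₂, hAB₂, ?_, h⟩
    rw [he₂, he₁, List.map_cons, List.sum_cons, ← natCast_zsmul, add_assoc]
    congr 2
    apply zsmul_eq_of_modEq
    · let K : AddSubgroup Q := (zsmulAddGroupHom (3 : ℤ)).ker
      refine stuffleSum_mem (N := K.toAddSubmonoid) _ _ _ fun w hw => ?_
      exact hy _ (by simp; omega)
    · change ((x.1 % 3).toNat : ℤ) ≡ _ [ZMOD 3]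
      rw [Int.toNat_of_nonneg (by omega)]
      exact Int.mod_modEq _ _

end Evaluation

/-! ### Truncated sums and their products -/

/-- The series `∑ v ^ m / m! * q ^ v` over `v > 0`. -/
def powSeries (m : ℕ) : PowerSeries ℚ :=
  mk fun v => if v = 0 then 0 else (v : ℚ) ^ m / m.factorial

/-- The span of the series `powSeries j` with `j < n`. -/
def powSpan (n : ℕ) : Submodule ℚ (PowerSeries ℚ) := Submodule.span ℚ (powSeries '' Set.Iio n)

theorem powSeries_mem {j n : ℕ} (h : j < n) : powSeries j ∈ powSpan n :=
  Submodule.subset_span ⟨j, h, rfl⟩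

theorem powSpan_mono {m n : ℕ} (h : m ≤ n) : powSpan m ≤ powSpan n :=
  Submodule.span_mono (Set.image_mono (Set.Iio_subset_Iio h))

/-- The derivation `q * d/dq`. -/
def eulerDeriv (f : PowerSeries ℚ) : PowerSeries ℚ := X * derivative ℚ f

theorem eulerDeriv_mul (f g : PowerSeries ℚ) :
    eulerDeriv (f * g) = eulerDeriv f * g + f * eulerDeriv g := by
  simp only [eulerDeriv, Derivation.leibniz, smul_eq_mul]; ring

theorem coeff_eulerDeriv (f : PowerSeries ℚ) (n : ℕ) :
    coeff n (eulerDeriv f) = n * coeff n f := by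
  rcases n with _ | n
  · simp [eulerDeriv]
  · rw [eulerDeriv, coeff_succ_X_mul, coeff_derivative]; push_cast; ring

theorem eulerDeriv_powSeries (m : ℕ) :
    eulerDeriv (powSeries m) = ((m : ℚ) + 1) • powSeries (m + 1) := by
  ext v
  rw [coeff_eulerDeriv, coeff_smul, powSeries, powSeries, coeff_mk, coeff_mk, smul_eq_mul]
  split_ifs
  · simp
  · have h1 : (m.factorial : ℚ) ≠ 0 := by exact_mod_cast m.factorial_ne_zero
    have h2 : (m : ℚ) + 1 ≠ 0 := by positivity
    rw [Nat.factorial_succ]; push_cast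
    field_simp
    ring

theorem eulerDeriv_mem {n : ℕ} {f : PowerSeries ℚ} (hf : f ∈ powSpan n) :
    eulerDeriv f ∈ powSpan (n + 1) := by
  induction hf using Submodule.span_induction with
  | mem x hx =>
    obtain ⟨j, hj, rfl⟩ := hx
    rw [eulerDeriv_powSeries]
    exact Submodule.smul_mem _ _ (powSeries_mem (Nat.succ_lt_succ hj))
  | zero => simp [eulerDeriv]
  | add f g _ _ hf hg =>
    have : eulerDeriv (f + g) = eulerDeriv f + eulerDeriv g := by simp [eulerDeriv, mul_add]
    rw [this]; exact add_mem hf hg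
  | smul c f _ hf =>
    have : eulerDeriv (c • f) = c • eulerDeriv f := by simp [eulerDeriv]
    rw [this]; exact Submodule.smul_mem _ _ hf

theorem powSeries_zero_mul_one_sub : powSeries 0 * (1 - X) = X := by
  ext n
  rw [mul_sub, mul_one, map_sub, powSeries, coeff_mk]
  rcases n with _ | _ | n <;> simp [coeff_succ_mul_X, coeff_X]

theorem powSeries_zero_mul_self : powSeries 0 * powSeries 0 = powSeries 1 - powSeries 0 := by
  have h := powSeries_zero_mul_one_sub
  have h1 : eulerDeriv (powSeries 0) = powSeries 1 := by simp [eulerDeriv_powSeries]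
  have h2 : powSeries 1 * (1 - X) - powSeries 0 * X = X := by
    have := congrArg eulerDeriv h
    rw [eulerDeriv_mul, h1] at this
    simpa [eulerDeriv, sub_eq_add_neg] using this
  have h3 : (1 - X : PowerSeries ℚ) ≠ 0 := by
    intro h
    simpa using congrArg (coeff 0) h
  apply mul_right_cancel₀ h3
  apply mul_right_cancel₀ h3
  linear_combination (powSeries 0 * (1 - X) + 1 - X) * h - (1 - X) * h2

theorem powSeries_zero_mul (b : ℕ) :
    powSeries 0 * powSeries b - powSeries (b + 1) ∈ powSpan (b + 1) := by
  induction b using Nat.strong_induction_on with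
  | _ b ih =>
  have hmul : ∀ {n : ℕ} {f : PowerSeries ℚ}, n ≤ b → f ∈ powSpan n →
      powSeries 0 * f ∈ powSpan (n + 1) := by
    intro n f hn hf
    induction hf using Submodule.span_induction with
    | mem x hx =>
      obtain ⟨j, hj, rfl⟩ := hx
      have hj : j < n := hj
      rw [← sub_add_cancel (powSeries 0 * powSeries j) (powSeries (j + 1))]
      exact add_mem (powSpan_mono (by omega) (ih j (by omega))) (powSeries_mem (by omega))
    | zero => simp
    | add f g _ _ hf hg => rw [mul_add]; exact add_mem hf hg
    | smul c f _ hf => rw [mul_smul_comm]; exact Submodule.smul_mem _ _ hf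
  rcases b with _ | b
  · rw [powSeries_zero_mul_self, sub_sub_cancel_left]
    exact neg_mem (powSeries_mem (by omega))
  -- With `p_b = p_{b+1} + lower` for `p_0 * p_b`, the derivative of `p_0 * p_b` and
  -- `p_1 = p_0 ^ 2 + p_0` determine `p_0 * p_{b+1}` up to lower terms.
  have h1 := ih b (by omega)
  have h2 : eulerDeriv (powSeries 0 * powSeries b - powSeries (b + 1)) =
      powSeries 1 * powSeries b + ((b : ℚ) + 1) • (powSeries 0 * powSeries (b + 1)) -
        ((b : ℚ) + 2) • powSeries (b + 2) := by
    have : eulerDeriv (powSeries 0 * powSeries b - powSeries (b + 1)) =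
      eulerDeriv (powSeries 0 * powSeries b) - eulerDeriv (powSeries (b + 1)) := by
      simp [eulerDeriv, mul_sub]
    rw [this, eulerDeriv_mul, eulerDeriv_powSeries, eulerDeriv_powSeries, eulerDeriv_powSeries]
    push_cast
    rw [mul_smul_comm, zero_add, one_smul]
    congr 2
    ring
  have h3 := eulerDeriv_mem h1
  have h4 := hmul (by omega) h1
  have h5 : powSeries 0 * powSeries b ∈ powSpan (b + 2) := by
    rw [← sub_add_cancel (powSeries 0 * powSeries b) (powSeries (b + 1))]
    exact add_mem (powSpan_mono (by omega) h1) (powSeries_mem (by omega))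
  have h6 : ((b : ℚ) + 2) • (powSeries 0 * powSeries (b + 1) - powSeries (b + 2)) =
      eulerDeriv (powSeries 0 * powSeries b - powSeries (b + 1)) -
        powSeries 0 * (powSeries 0 * powSeries b - powSeries (b + 1)) -
          powSeries 0 * powSeries b := by
    rw [h2, eq_add_of_sub_eq powSeries_zero_mul_self.symm]
    simp only [smul_eq_C_mul, map_add, map_natCast, map_one, map_ofNat]
    ring
  have h7 : ((b : ℚ) + 2) ≠ 0 := by positivity
  rw [← inv_smul_smul₀ h7 (powSeries 0 * powSeries (b + 1) - powSeries (b + 1 + 1)), h6]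
  exact Submodule.smul_mem _ _ (sub_mem (sub_mem h3 h4) h5)

/-- Up to lower terms, the convolution of `v ^ a / a!` and `v ^ b / b!` is
`v ^ (a + b + 1) / (a + b + 1)!`. -/
theorem powSeries_mul (a b : ℕ) :
    powSeries a * powSeries b - powSeries (a + b + 1) ∈ powSpan (a + b + 1) := by
  induction a generalizing b with
  | zero => simpa using powSeries_zero_mul b
  | succ a ih =>
    have h1 := eulerDeriv_mem (ih b)
    have h2 : ((a : ℚ) + 1) • (powSeries (a + 1) * powSeries b - powSeries (a + b + 2)) =
        eulerDeriv (powSeries a * powSeries b - powSeries (a + b + 1)) -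
          ((b : ℚ) + 1) • (powSeries a * powSeries (b + 1) - powSeries (a + b + 2)) := by
      have : eulerDeriv (powSeries a * powSeries b - powSeries (a + b + 1)) =
        eulerDeriv (powSeries a * powSeries b) - eulerDeriv (powSeries (a + b + 1)) := by
        simp [eulerDeriv, mul_sub]
      rw [this, eulerDeriv_mul, eulerDeriv_powSeries, eulerDeriv_powSeries, eulerDeriv_powSeries]
      simp only [smul_eq_C_mul, map_add, map_natCast, map_one, Nat.cast_add, Nat.cast_one]
      ring
    have h7 : ((a : ℚ) + 1) ≠ 0 := by positivity
    rw [show a + 1 + b + 1 = a + b + 2 by ring,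
      ← inv_smul_smul₀ h7 (powSeries (a + 1) * powSeries b - powSeries (a + b + 2)), h2]
    exact Submodule.smul_mem _ _ (sub_mem h1 (Submodule.smul_mem _ _ (ih (b + 1))))

theorem exists_powSeries_mul (a b : ℕ) : ∃ d : ℕ → ℚ, powSeries a * powSeries b =
    powSeries (a + b + 1) + ∑ j ∈ Finset.range (a + b + 1), d j • powSeries j := by
  have h := powSeries_mul a b
  rw [powSpan, ← Finset.coe_Iio, Nat.Iio_eq_range,
    Submodule.mem_span_image_finset_iff_exists_fun'] at h
  obtain ⟨d, hd⟩ := h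
  exact ⟨d, by rw [hd]; ring⟩

/-- The series `∑ v ^ m / m! * q ^ (u * v)` over `v > 0`, where `u = i + 1`. -/
def dilate (m i : ℕ) : PowerSeries ℚ := expand (i + 1) i.succ_ne_zero (powSeries m)

/-- The operator that adds a letter in front of a truncated sum: the value at `N` is the sum over
`0 < u ≤ N` of `u ^ r / r! * v ^ m / m! * q ^ (u * v) * f (u - 1)`, where also `v > 0` varies. -/
def consSum (x : ℕ × ℕ) : (ℕ → PowerSeries ℚ) →ₗ[ℚ] (ℕ → PowerSeries ℚ) where
  toFun f N := ∑ i ∈ Finset.range N,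
    (((i + 1 : ℕ) : ℚ) ^ x.2 / x.2.factorial) • (dilate x.1 i * f i)
  map_add' f g := by
    ext1 N; simp only [Pi.add_apply, mul_add, smul_add, Finset.sum_add_distrib]
  map_smul' c f := by
    ext1 N
    simp only [Pi.smul_apply, RingHom.id_apply, Finset.smul_sum]
    exact Finset.sum_congr rfl fun i _ => by rw [mul_smul_comm, smul_comm]

theorem consSum_apply (x : ℕ × ℕ) (f : ℕ → PowerSeries ℚ) (N : ℕ) :
    consSum x f N = ∑ i ∈ Finset.range N,
      (((i + 1 : ℕ) : ℚ) ^ x.2 / x.2.factorial) • (dilate x.1 i * f i) := rfl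

/-- The part of the bi-bracket with `u_1 ≤ N`, as a function of `N`. -/
def truncSum : Word → ℕ → PowerSeries ℚ
  | [] => 1
  | x :: w => consSum x (truncSum w)

/-- The span of the truncated sums of weight less than `k`. -/
def truncSpan (k : ℕ) : Submodule ℚ (ℕ → PowerSeries ℚ) :=
  Submodule.span ℚ {f | ∃ w, wt w < k ∧ f = truncSum w}

theorem truncSum_mem {w : Word} {k : ℕ} (h : wt w < k) : truncSum w ∈ truncSpan k :=
  Submodule.subset_span ⟨w, h, rfl⟩

theorem truncSpan_mono {k l : ℕ} (h : k ≤ l) : truncSpan k ≤ truncSpan l :=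
  Submodule.span_mono fun _ ⟨w, hw, hf⟩ => ⟨w, hw.trans_le h, hf⟩

theorem consSum_mem {k l : ℕ} (x : ℕ × ℕ) (hl : x.1 + x.2 + 1 + k ≤ l)
    {f : ℕ → PowerSeries ℚ} (hf : f ∈ truncSpan k) : consSum x f ∈ truncSpan l := by
  have h : truncSpan k ≤ (truncSpan l).comap (consSum x) := by
    refine Submodule.span_le.2 ?_
    rintro _ ⟨w, hw, rfl⟩
    exact truncSum_mem (w := x :: w) (by simp; omega)
  exact h hf

theorem sum_mul_sum_range {R : Type*} [CommRing R] (a b : ℕ → R) (N : ℕ) :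
    (∑ i ∈ Finset.range N, a i) * ∑ i ∈ Finset.range N, b i =
      ∑ i ∈ Finset.range N, a i * ∑ j ∈ Finset.range i, b j +
        ∑ i ∈ Finset.range N, b i * ∑ j ∈ Finset.range i, a j +
          ∑ i ∈ Finset.range N, a i * b i := by
  induction N with
  | zero => simp
  | succ N ih =>
    simp only [Finset.sum_range_succ]
    linear_combination ih

theorem choose_mul_pow_div (x : ℚ) (a b : ℕ) : x ^ a / a.factorial * (x ^ b / b.factorial) =
    (a + b).choose a * (x ^ (a + b) / (a + b).factorial) := by
  have h1 : ((a + b).choose a : ℚ) * a.factorial * b.factorial = (a + b).factorial := by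
    rw [Nat.choose_symm_add]
    exact_mod_cast Nat.add_choose_mul_factorial_mul_factorial a b
  have h2 : (a.factorial : ℚ) ≠ 0 := by exact_mod_cast a.factorial_ne_zero
  have h3 : (b.factorial : ℚ) ≠ 0 := by exact_mod_cast b.factorial_ne_zero
  have h4 : ((a + b).factorial : ℚ) ≠ 0 := by exact_mod_cast (a + b).factorial_ne_zero
  field_simp
  rw [← h1]; ring

theorem consSum_mul_consSum (x y : ℕ × ℕ) : ∃ d : ℕ → ℚ, ∀ f g : ℕ → PowerSeries ℚ,
    consSum x f * consSum y g = consSum x (f * consSum y g) + consSum y (consSum x f * g) +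
      (x.2 + y.2).choose x.2 • (consSum (x.1 + y.1 + 1, x.2 + y.2) (f * g) +
        ∑ j ∈ Finset.range (x.1 + y.1 + 1), d j • consSum (j, x.2 + y.2) (f * g)) := by
  obtain ⟨d, hd⟩ := exists_powSeries_mul x.1 y.1
  refine ⟨d, fun f g => ?_⟩
  ext1 N
  have hdil : ∀ i, dilate x.1 i * dilate y.1 i = dilate (x.1 + y.1 + 1) i +
      ∑ j ∈ Finset.range (x.1 + y.1 + 1), d j • dilate j i := by
    intro i
    simp only [dilate]
    rw [← map_mul, hd, map_add, map_sum]
    simp only [map_smul]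
  simp only [Pi.mul_apply, Pi.add_apply, Pi.smul_apply, Finset.sum_apply, consSum_apply]
  rw [sum_mul_sum_range]
  congr 1
  · congr 1
    · refine Finset.sum_congr rfl fun i _ => ?_
      rw [smul_mul_assoc, mul_assoc]
    · refine Finset.sum_congr rfl fun i _ => ?_
      rw [smul_mul_assoc]
      congr 1
      ring
  · simp only [Finset.smul_sum]
    rw [Finset.sum_comm, ← Finset.sum_add_distrib, Finset.smul_sum]
    refine Finset.sum_congr rfl fun i _ => ?_
    rw [smul_mul_smul_comm, choose_mul_pow_div, mul_smul, Nat.cast_smul_eq_nsmul]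
    congr 1
    have : dilate x.1 i * f i * (dilate y.1 i * g i) =
        dilate x.1 i * dilate y.1 i * (f i * g i) := by ring
    rw [this, hdil, add_mul, smul_add, Finset.sum_mul, Finset.smul_sum]
    congr 1
    refine Finset.sum_congr rfl fun j _ => ?_
    rw [smul_mul_assoc, smul_comm]

/-- Up to truncated sums of lower weight, a product of truncated sums is the leading part of the
stuffle product. -/
theorem truncSum_mul : ∀ a b : Word, truncSum a * truncSum b - stuffleSum truncSum a b ∈
    truncSpan (wt a + wt b)
  | [], b => by simp [truncSum]
  | x :: a, [] => by simp [truncSum]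
  | x :: a, y :: b => by
    have h1 := truncSum_mul a (y :: b)
    have h2 := truncSum_mul (x :: a) b
    have h3 := truncSum_mul a b
    have h4 : truncSum a * truncSum b ∈ truncSpan (wt a + wt b + 1) := by
      rw [← sub_add_cancel (truncSum a * truncSum b) (stuffleSum truncSum a b)]
      refine add_mem (truncSpan_mono (Nat.le_succ _) h3) ?_
      exact stuffleSum_mem (N := (truncSpan (wt a + wt b + 1)).toAddSubmonoid) _ _ _
        fun w hw => truncSum_mem (by omega)
    have hmap : ∀ (z : ℕ × ℕ) (a b : Word),
        stuffleSum (fun w => truncSum (z :: w)) a b = consSum z (stuffleSum truncSum a b) :=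
      fun z a b => (map_stuffleSum (consSum z).toAddMonoidHom truncSum a b).symm
    obtain ⟨d, hd⟩ := consSum_mul_consSum x y
    have key : truncSum (x :: a) * truncSum (y :: b) - stuffleSum truncSum (x :: a) (y :: b) =
        consSum x (truncSum a * truncSum (y :: b) - stuffleSum truncSum a (y :: b)) +
        consSum y (truncSum (x :: a) * truncSum b - stuffleSum truncSum (x :: a) b) +
        (x.2 + y.2).choose x.2 • (consSum (x.1 + y.1 + 1, x.2 + y.2)
            (truncSum a * truncSum b - stuffleSum truncSum a b) +
          ∑ j ∈ Finset.range (x.1 + y.1 + 1),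
            d j • consSum (j, x.2 + y.2) (truncSum a * truncSum b)) := by
      rw [stuffleSum_cons_cons, hmap, hmap, hmap, map_sub, map_sub, map_sub, smul_add, smul_sub]
      have := hd (truncSum a) (truncSum b)
      rw [smul_add] at this
      change consSum x (truncSum a) * consSum y (truncSum b) - _ = _
      rw [this]
      simp only [truncSum]
      abel
    rw [key]
    refine add_mem (add_mem ?_ ?_) (nsmul_mem (add_mem ?_ (sum_mem fun j hj => ?_)) _)
    · exact consSum_mem x (by simp; omega) h1
    · exact consSum_mem y (by simp; omega) h2
    · exact consSum_mem _ (by simp; omega) h3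
    · have hj := Finset.mem_range.1 hj
      exact Submodule.smul_mem _ _ (consSum_mem _ (by simp; omega) h4)
  termination_by a b => a.length + b.length

/-! ### Bi-brackets and their products -/

/-- The bi-bracket of a word. -/
def biSeries (w : Word) : PowerSeries ℚ :=
  biBracket (fun j : Fin w.length => (w.get j).1 + 1) fun j => (w.get j).2

/-- The coefficient of `q ^ (u_1 v_1 + ⋯ + u_l v_l)` that the tuples `u` and `v` contribute to the
bi-bracket of a word. -/
def wordTerm (w : Word) (u v : Fin w.length → ℕ) : ℚ :=
  ∏ j, ((u j : ℚ) ^ (w.get j).2 / (w.get j).2.factorial) *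
    ((v j : ℚ) ^ (w.get j).1 / (w.get j).1.factorial)

theorem coeff_biSeries (w : Word) (n : ℕ) :
    coeff n (biSeries w) = ∑ p ∈ biIndex w.length n, wordTerm w p.1 p.2 := by
  simp only [biSeries, biBracket, coeff_mk, wordTerm, Nat.add_sub_cancel]

theorem wordTerm_cons (x : ℕ × ℕ) (w : Word) (u v : Fin (x :: w).length → ℕ) :
    wordTerm (x :: w) u v = ((u 0 : ℚ) ^ x.2 / x.2.factorial) * ((v 0 : ℚ) ^ x.1 / x.1.factorial) *
      wordTerm w (fun j => u j.succ) fun j => v j.succ :=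
  Fin.prod_univ_succ (n := w.length) _

theorem strictAnti_fin_succ {l : ℕ} (u : Fin (l + 1) → ℕ) :
    StrictAnti u ↔ (∀ j : Fin l, u j.succ < u 0) ∧ StrictAnti fun j : Fin l => u j.succ := by
  constructor
  · exact fun h => ⟨fun j => h j.succ_pos, fun i j hij => h (Fin.succ_lt_succ_iff.2 hij)⟩
  · rintro ⟨h0, h⟩ i j hij
    induction j using Fin.cases with
    | zero => exact absurd hij (Fin.not_lt_zero i)
    | succ j =>
      induction i using Fin.cases with
      | zero => exact h0 j
      | succ i => exact h (Fin.succ_lt_succ_iff.1 hij)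

theorem coeff_dilate (m i n : ℕ) : coeff n (dilate m i) =
    if i + 1 ∣ n ∧ n ≠ 0 then (((n / (i + 1) : ℕ) : ℚ) ^ m / m.factorial) else 0 := by
  rw [dilate, coeff_expand, powSeries]
  split_ifs with h1 h2 h2
  · rw [coeff_mk, if_neg]
    exact (Nat.div_pos (Nat.le_of_dvd (Nat.pos_of_ne_zero h2.2) h1) i.succ_pos).ne'
  · have : n = 0 := by simpa [h1] using h2
    simp [this]
  · exact absurd h2.1 h1
  · rfl

/-- The coefficients of a truncated sum are the truncated sums of the coefficients. -/
theorem coeff_truncSum (w : Word) (N n : ℕ) : coeff n (truncSum w N) =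
    ∑ p ∈ biIndex w.length n with ∀ j, p.1 j ≤ N, wordTerm w p.1 p.2 := by
  induction w generalizing N n with
  | nil =>
    rw [truncSum, Pi.one_apply, coeff_one]
    by_cases h : n = 0
    · subst h
      rw [if_pos rfl, Finset.filter_true_of_mem fun p _ j => j.elim0, Finset.sum_eq_single default]
      · simp [wordTerm]
      · intro p _ hp; exact absurd (Prod.ext (funext fun j => j.elim0) (funext fun j => j.elim0)) hp
      · intro h
        exact absurd ((mem_biIndex _).2
          ⟨fun j => j.elim0, fun j => j.elim0, fun j => j.elim0, by simp⟩) h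
    · rw [if_neg h, Finset.sum_eq_zero]
      intro p hp
      have := ((mem_biIndex p).1 (Finset.mem_filter.1 hp).1).2.2.2
      simp at this
      exact absurd this.symm h
  | cons x w ih =>
    rw [truncSum, consSum_apply, map_sum]
    have h1 : ∀ i ∈ Finset.range N, coeff n ((((i + 1 : ℕ) : ℚ) ^ x.2 / x.2.factorial) •
        (dilate x.1 i * truncSum w i)) =
        ∑ ab ∈ Finset.HasAntidiagonal.antidiagonal n with i + 1 ∣ ab.1 ∧ ab.1 ≠ 0,
          ∑ p ∈ biIndex w.length ab.2 with ∀ j, p.1 j ≤ i,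
            (((i + 1 : ℕ) : ℚ) ^ x.2 / x.2.factorial) *
              ((((ab.1 / (i + 1) : ℕ) : ℚ) ^ x.1 / x.1.factorial)) * wordTerm w p.1 p.2 := by
      intro i _
      rw [coeff_smul, coeff_mul, smul_eq_mul, Finset.mul_sum, Finset.sum_filter]
      refine Finset.sum_congr rfl fun ab _ => ?_
      rw [coeff_dilate, ih]
      split_ifs
      · rw [← mul_assoc, Finset.mul_sum]
      · simp
    rw [Finset.sum_congr rfl h1]
    simp only [Finset.sum_sigma']
    refine Finset.sum_nbij'
      (fun t => (Fin.cons (t.1 + 1) t.2.2.1, Fin.cons (t.2.1.1 / (t.1 + 1)) t.2.2.2))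
      (fun p => ⟨p.1 0 - 1, (p.1 0 * p.2 0, ∑ j : Fin w.length, p.1 j.succ * p.2 j.succ),
        fun j => p.1 j.succ, fun j => p.2 j.succ⟩) ?_ ?_ ?_ ?_ ?_
    · rintro ⟨i, ⟨a, b⟩, u, v⟩ ht
      simp only [Finset.mem_sigma, Finset.mem_range, Finset.mem_filter,
        Finset.HasAntidiagonal.mem_antidiagonal, mem_biIndex] at ht
      obtain ⟨hi, ⟨hab, hdvd, ha⟩, ⟨hu, hu0, hv0, hb⟩, hui⟩ := ht
      rw [Finset.mem_filter, mem_biIndex]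
      refine ⟨⟨(strictAnti_fin_succ _).2 ⟨fun j => ?_, ?_⟩, ?_, ?_, ?_⟩, ?_⟩
      · exact Nat.lt_succ_of_le (hui j)
      · exact hu
      · exact Fin.cases i.succ_pos hu0
      · exact Fin.cases (Nat.div_pos (Nat.le_of_dvd (Nat.pos_of_ne_zero ha) hdvd) i.succ_pos) hv0
      · refine (Fin.sum_univ_succ (n := w.length) _).trans ?_
        simp only [Fin.cons_zero, Fin.cons_succ]
        rw [Nat.mul_div_cancel' hdvd, hb, hab]
      · exact Fin.cases hi fun j => (hui j).trans hi.le
    · rintro ⟨u, v⟩ hp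
      rw [Finset.mem_filter, mem_biIndex] at hp
      obtain ⟨⟨hu, hu0, hv0, hn⟩, hN⟩ := hp
      obtain ⟨hu1, hu2⟩ := (strictAnti_fin_succ _).1 hu
      have h0 := hu0 0
      have hv := hv0 0
      have hN0 := hN 0
      simp only [Finset.mem_sigma, Finset.mem_range, Finset.mem_filter,
        Finset.HasAntidiagonal.mem_antidiagonal, mem_biIndex]
      simp only at h0 hv hN0
      have hsucc : u 0 - 1 + 1 = u 0 := Nat.sub_add_cancel h0
      refine ⟨by omega, ⟨(Fin.sum_univ_succ (n := w.length) _).symm.trans hn, ?_, ?_⟩,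
        ⟨hu2, fun j => hu0 _, fun j => hv0 _, trivial⟩, fun j => ?_⟩
      · rw [hsucc]; exact dvd_mul_right _ _
      · positivity
      · have := hu1 j
        simp only at this
        omega
    · rintro ⟨i, ⟨a, b⟩, u, v⟩ ht
      simp only [Finset.mem_sigma, Finset.mem_range, Finset.mem_filter,
        Finset.HasAntidiagonal.mem_antidiagonal, mem_biIndex] at ht
      obtain ⟨hi, ⟨hab, hdvd, ha⟩, ⟨hu, hu0, hv0, hb⟩, hui⟩ := ht
      simp only [Fin.cons_zero, Fin.cons_succ, Nat.add_sub_cancel, Nat.mul_div_cancel' hdvd, hb]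
    · rintro ⟨u, v⟩ hp
      rw [Finset.mem_filter, mem_biIndex] at hp
      obtain ⟨⟨hu, hu0, hv0, hn⟩, hN⟩ := hp
      have h0 := hu0 0
      simp only at h0
      have hsucc : u 0 - 1 + 1 = u 0 := Nat.sub_add_cancel h0
      refine Prod.ext (funext (Fin.cases ?_ fun j => ?_)) (funext (Fin.cases ?_ fun j => ?_))
      · exact hsucc
      · rfl
      · simp only [Fin.cons_zero, hsucc]
        exact Nat.mul_div_cancel_left _ h0
      · rfl
    · rintro ⟨i, ⟨a, b⟩, u, v⟩ _
      rw [wordTerm_cons]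
      simp only [Fin.cons_zero, Fin.cons_succ]

theorem coeff_truncSum_of_le (w : Word) {n N : ℕ} (h : n ≤ N) :
    coeff n (truncSum w N) = coeff n (biSeries w) := by
  rw [coeff_truncSum, coeff_biSeries, Finset.filter_true_of_mem]
  intro p hp j
  obtain ⟨_, _, hv, hn⟩ := (mem_biIndex p).1 hp
  refine le_trans ?_ h
  rw [← hn]
  exact (Nat.le_mul_of_pos_right _ (hv j)).trans
    (Finset.single_le_sum (f := fun j => p.1 j * p.2 j) (fun _ _ => Nat.zero_le _)
      (Finset.mem_univ j))

/-- The limit of a sequence of power series whose `n`-th coefficients do not change from the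
index `n` on. -/
def coeffLimit : (ℕ → PowerSeries ℚ) →ₗ[ℚ] PowerSeries ℚ where
  toFun f := mk fun n => coeff n (f n)
  map_add' f g := by ext n; simp
  map_smul' c f := by ext n; simp

theorem coeffLimit_apply (f : ℕ → PowerSeries ℚ) (n : ℕ) :
    coeff n (coeffLimit f) = coeff n (f n) := coeff_mk n fun n => coeff n (f n)

theorem coeffLimit_truncSum (w : Word) : coeffLimit (truncSum w) = biSeries w := by
  ext n
  rw [coeffLimit_apply, coeff_truncSum_of_le w le_rfl]

theorem coeffLimit_mul (a b : Word) :
    coeffLimit (truncSum a * truncSum b) = biSeries a * biSeries b := by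
  ext n
  rw [coeffLimit_apply, Pi.mul_apply, coeff_mul, coeff_mul]
  refine Finset.sum_congr rfl fun ij hij => ?_
  rw [coeff_truncSum_of_le a (Finset.HasAntidiagonal.antidiagonal.fst_le hij),
    coeff_truncSum_of_le b (Finset.HasAntidiagonal.antidiagonal.snd_le hij)]

/-- The span of the bi-brackets of weight less than `k`. -/
def biSpan (k : ℕ) : Submodule ℚ (PowerSeries ℚ) :=
  Submodule.span ℚ {f | ∃ w, wt w < k ∧ f = biSeries w}

theorem biSeries_mem {w : Word} {k : ℕ} (h : wt w < k) : biSeries w ∈ biSpan k :=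
  Submodule.subset_span ⟨w, h, rfl⟩

/-- Up to lower weight, a product of bi-brackets is the leading part of the stuffle product. -/
theorem biSeries_mul (a b : Word) :
    biSeries a * biSeries b - stuffleSum biSeries a b ∈ biSpan (wt a + wt b) := by
  have h : truncSpan (wt a + wt b) ≤ (biSpan (wt a + wt b)).comap coeffLimit := by
    refine Submodule.span_le.2 ?_
    rintro _ ⟨w, hw, rfl⟩
    change coeffLimit _ ∈ biSpan _
    rw [coeffLimit_truncSum]
    exact biSeries_mem hw
  have h2 := h (truncSum_mul a b)
  rw [Submodule.mem_comap, map_sub, coeffLimit_mul] at h2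
  have h3 : coeffLimit (stuffleSum truncSum a b) = stuffleSum biSeries a b := by
    rw [show coeffLimit (stuffleSum truncSum a b) = _ from
      map_stuffleSum coeffLimit.toAddMonoidHom truncSum a b]
    simp only [LinearMap.toAddMonoidHom_coe, coeffLimit_truncSum]
  rwa [h3] at h2

/-! ### Conjugation of partitions -/

/-- The product of the divided power `u ^ t / t!` of the first entry `u` of the upper row with the
monomial of a word. -/
def raiseHead (t : ℕ) : Word → List (ℤ × Word)
  | [] => bif Nat.beq t 0 then [(1, [])] else []
  | x :: w => [(Int.ofNat (Nat.choose (Nat.add x.2 t) t), (x.1, Nat.add x.2 t) :: w)]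

/-- The sign `(-1) ^ t`. -/
def altSign (t : ℕ) : ℤ := bif Nat.beq (Nat.mod t 2) 0 then 1 else -1

/-- The expansion of `∏ j, (s + v_1 + ⋯ + v_j) ^ r_j / r_j! * (u_j - u_{j+1}) ^ m_j / m_j!` into
divided powers. An entry `(c, e, w)` stands for the term `c * s ^ e / e!` times the monomial of
the word `w`. -/
def dualAux : Word → List (ℤ × ℕ × Word)
  | [] => [(1, 0, [])]
  | x :: w => (dualAux w).flatMap fun z =>
      (List.range (z.2.1 + x.2 + 1)).flatMap fun i =>
        (List.range (x.1 + 1)).flatMap fun t =>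
          (raiseHead t z.2.2).map fun y =>
            (Int.mul (Int.mul (altSign t) (Int.ofNat (Nat.choose (z.2.1 + x.2) z.2.1)))
              (Int.mul z.1 y.1), z.2.1 + x.2 - i, (i, x.1 - t) :: y.2)

/-- The bi-bracket of a word as a linear combination of bi-brackets by conjugation of partitions:
the tuples `u` and `v` are replaced by the partial sums of `v` and by the differences of `u`. -/
def dual (w : Word) : List (ℤ × Word) :=
  ((dualAux w.reverse).filter fun x => Nat.beq x.2.1 0).map fun x => (x.1, x.2.2)

theorem altSign_eq (t : ℕ) : altSign t = (-1) ^ t := by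
  rw [altSign, Bool.cond_eq_ite]
  split_ifs with h
  · have h : t % 2 = 0 := Nat.eq_of_beq_eq_true h
    rw [Even.neg_one_pow (Nat.even_iff.2 h)]
  · have h : t % 2 ≠ 0 := fun h' => h (by rw [show Nat.mod t 2 = 0 from h']; rfl)
    rw [Odd.neg_one_pow (Nat.odd_iff.2 (by omega))]

theorem raiseHead_spec {t : ℕ} {w : Word} {y : ℤ × Word} (h : y ∈ raiseHead t w) :
    y.2.length = w.length ∧ wt y.2 = wt w + t := by
  cases w with
  | nil =>
    rw [raiseHead, Bool.cond_eq_ite] at h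
    split_ifs at h with h0
    · have h0 : t = 0 := Nat.eq_of_beq_eq_true h0
      simp at h; simp [h, h0]
    · simp at h
  | cons x w =>
    simp only [raiseHead, List.mem_singleton] at h
    subst h
    simp; omega

theorem dualAux_spec {w : Word} {z : ℤ × ℕ × Word} (h : z ∈ dualAux w) :
    z.2.2.length = w.length ∧ wt z.2.2 + z.2.1 = wt w := by
  induction w generalizing z with
  | nil => simp [dualAux] at h; simp [h]
  | cons x w ih =>
    simp only [dualAux, List.mem_flatMap, List.mem_map, List.mem_range] at h
    obtain ⟨z', hz', i, hi, t, ht, y, hy, rfl⟩ := h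
    have h1 := ih hz'
    have h2 := raiseHead_spec hy
    refine ⟨by simp [h1.1, h2.1], ?_⟩
    simp only [wt_cons]
    omega

theorem wt_reverse (w : Word) : wt w.reverse = wt w := by
  induction w with
  | nil => rfl
  | cons x w ih => simp [ih]; omega

theorem wt_of_mem_dual {w : Word} {x : ℤ × Word} (h : x ∈ dual w) :
    x.2.length = w.length ∧ wt x.2 = wt w := by
  simp only [dual, List.mem_map, List.mem_filter] at h
  obtain ⟨z, ⟨hz, h0⟩, rfl⟩ := h
  have h0 : z.2.1 = 0 := Nat.eq_of_beq_eq_true h0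
  have := dualAux_spec hz
  rw [wt_reverse, List.length_reverse, h0] at this
  exact this

/-- The divided power `x ^ n / n!`. -/
def divPow (x : ℚ) (n : ℕ) : ℚ := x ^ n / n.factorial

@[simp] theorem divPow_zero_right (x : ℚ) : divPow x 0 = 1 := by simp [divPow]

theorem divPow_zero_left {n : ℕ} (h : n ≠ 0) : divPow 0 n = 0 := by simp [divPow, h]

theorem divPow_mul (x : ℚ) (a b : ℕ) :
    divPow x a * divPow x b = (a + b).choose a * divPow x (a + b) := choose_mul_pow_div x a b

theorem divPow_add (x y : ℚ) (n : ℕ) :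
    divPow (x + y) n = ∑ i ∈ Finset.range (n + 1), divPow x (n - i) * divPow y i := by
  rw [divPow, add_comm, add_pow, Finset.sum_div]
  refine Finset.sum_congr rfl fun i hi => ?_
  have hi := Nat.lt_succ_iff.1 (Finset.mem_range.1 hi)
  have h1 : (n.choose i : ℚ) * i.factorial * (n - i).factorial = n.factorial := by
    exact_mod_cast Nat.choose_mul_factorial_mul_factorial hi
  have h2 : (i.factorial : ℚ) ≠ 0 := by exact_mod_cast i.factorial_ne_zero
  have h3 : ((n - i).factorial : ℚ) ≠ 0 := by exact_mod_cast (n - i).factorial_ne_zero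
  have h4 : (n.factorial : ℚ) ≠ 0 := by exact_mod_cast n.factorial_ne_zero
  rw [divPow, divPow]
  field_simp
  rw [← h1]; ring

theorem divPow_sub (x y : ℚ) (n : ℕ) : divPow (x - y) n =
    ∑ i ∈ Finset.range (n + 1), (altSign i : ℚ) * (divPow x (n - i) * divPow y i) := by
  rw [sub_eq_add_neg, divPow_add]
  refine Finset.sum_congr rfl fun i _ => ?_
  have : divPow (-y) i = (-1) ^ i * divPow y i := by rw [divPow, neg_pow, mul_div_assoc, divPow]
  rw [this, altSign_eq]; push_cast; ring

/-- The monomial of a word, with divided powers of the first entries of two sequences. -/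
def monomialValue : Word → (ℕ → ℚ) → (ℕ → ℚ) → ℚ
  | [], _, _ => 1
  | x :: w, u, v => divPow (v 0) x.1 * divPow (u 0) x.2 *
      monomialValue w (fun i => u (i + 1)) fun i => v (i + 1)

/-- The product that `dualAux` expands. -/
def conjValue : ℚ → Word → (ℕ → ℚ) → (ℕ → ℚ) → ℚ
  | _, [], _, _ => 1
  | s, x :: w, u, v => divPow (s + v 0) x.2 * divPow (u 0 - u 1) x.1 *
      conjValue (s + v 0) w (fun i => u (i + 1)) fun i => v (i + 1)

theorem sum_map_flatMap {α β : Type*} (l : List α) (f : α → List β) (g : β → ℚ) :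
    ((l.flatMap f).map g).sum = (l.map fun a => ((f a).map g).sum).sum := by
  induction l with
  | nil => rfl
  | cons a l ih => simp [ih]

theorem sum_map_range (n : ℕ) (g : ℕ → ℚ) :
    ((List.range n).map g).sum = ∑ i ∈ Finset.range n, g i := rfl

theorem raiseHead_value (t : ℕ) (w : Word) (u v : ℕ → ℚ) (hu : w = [] → u 0 = 0) :
    ((raiseHead t w).map fun y => (y.1 : ℚ) * monomialValue y.2 u v).sum =
      divPow (u 0) t * monomialValue w u v := by
  cases w with
  | nil =>
    rw [raiseHead, Bool.cond_eq_ite, hu rfl]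
    split_ifs with h
    · have h : t = 0 := Nat.eq_of_beq_eq_true h
      simp [h]
    · have h : t ≠ 0 := fun h' => h (by rw [h']; rfl)
      simp [divPow_zero_left h]
  | cons x w =>
    simp only [raiseHead, List.map_cons, List.map_nil, List.sum_cons, List.sum_nil, add_zero,
      monomialValue]
    have h1 := divPow_mul (u 0) t x.2
    rw [add_comm t x.2] at h1
    change (((x.2 + t).choose t : ℕ) : ℚ) * (_ * divPow (u 0) (x.2 + t) * _) = _
    linear_combination (-divPow (v 0) x.1 *
      monomialValue w (fun i => u (i + 1)) fun i => v (i + 1)) * h1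

theorem dualAux_value (w : Word) (s : ℚ) (u v : ℕ → ℚ) (hu : u w.length = 0) :
    ((dualAux w).map fun z => (z.1 : ℚ) * divPow s z.2.1 * monomialValue z.2.2 u v).sum =
      conjValue s w u v := by
  induction w generalizing s u v with
  | nil => simp [dualAux, conjValue, monomialValue]
  | cons x w ih =>
    rw [dualAux, conjValue, ← ih _ _ _ hu, sum_map_flatMap, ← List.sum_map_mul_left]
    refine congrArg List.sum (List.map_congr_left fun z hz => ?_)
    have hlen := (dualAux_spec hz).1
    have h1 : divPow (s + v 0) x.2 * divPow (s + v 0) z.2.1 = (z.2.1 + x.2).choose z.2.1 *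
        ∑ i ∈ Finset.range (z.2.1 + x.2 + 1), divPow s (z.2.1 + x.2 - i) * divPow (v 0) i := by
      rw [← divPow_add, ← divPow_mul]; ring
    have h2 : divPow (u 0 - u 1) x.1 *
        monomialValue z.2.2 (fun i => u (i + 1)) (fun i => v (i + 1)) =
        ∑ t ∈ Finset.range (x.1 + 1), (altSign t : ℚ) * divPow (u 0) (x.1 - t) *
          ((raiseHead t z.2.2).map fun y => (y.1 : ℚ) *
            monomialValue y.2 (fun i => u (i + 1)) fun i => v (i + 1)).sum := by
      rw [divPow_sub, Finset.sum_mul]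
      refine Finset.sum_congr rfl fun t _ => ?_
      rw [raiseHead_value]
      · ring
      · intro h
        rw [h, List.length_nil] at hlen
        rwa [List.length_cons, ← hlen] at hu
    have h3 : divPow (s + v 0) x.2 * divPow (u 0 - u 1) x.1 * ((z.1 : ℚ) *
          divPow (s + v 0) z.2.1 *
            monomialValue z.2.2 (fun i => u (i + 1)) fun i => v (i + 1)) =
        (z.1 : ℚ) * (divPow (s + v 0) x.2 * divPow (s + v 0) z.2.1) *
          (divPow (u 0 - u 1) x.1 *
            monomialValue z.2.2 (fun i => u (i + 1)) fun i => v (i + 1)) := by ring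
    rw [h3, h1, sum_map_flatMap, sum_map_range, Finset.mul_sum, Finset.mul_sum, Finset.sum_mul]
    refine Finset.sum_congr rfl fun i _ => ?_
    rw [h2, sum_map_flatMap, sum_map_range, Finset.mul_sum]
    refine Finset.sum_congr rfl fun t _ => ?_
    rw [← List.sum_map_mul_left, ← List.sum_map_mul_left, List.map_map]
    refine congrArg List.sum (List.map_congr_left fun y _ => ?_)
    simp only [Function.comp_apply, monomialValue]
    change ((altSign t * ((z.2.1 + x.2).choose z.2.1 : ℕ) * (z.1 * y.1) : ℤ) : ℚ) * _ * _ = _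
    push_cast
    ring

theorem dual_value (w : Word) (u v : ℕ → ℚ) (hu : u w.length = 0) :
    ((dual w).map fun x => (x.1 : ℚ) * monomialValue x.2 u v).sum =
      conjValue 0 w.reverse u v := by
  rw [← dualAux_value _ _ _ _ (by rwa [List.length_reverse]), dual, List.map_map]
  induction dualAux w.reverse with
  | nil => rfl
  | cons z L ih =>
    rw [List.filter_cons]
    split_ifs with h
    · have h : z.2.1 = 0 := Nat.eq_of_beq_eq_true h
      rw [List.map_cons, List.sum_cons, ih, List.map_cons, List.sum_cons, h]
      simp
    · have h : z.2.1 ≠ 0 := fun h' => h (by rw [h']; rfl)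
      rw [ih, List.map_cons, List.sum_cons, divPow_zero_left h]
      simp

theorem monomialValue_eq (w : Word) (u v : ℕ → ℚ) : monomialValue w u v =
    ∏ j : Fin w.length, divPow (u j) (w.get j).2 * divPow (v j) (w.get j).1 := by
  induction w generalizing u v with
  | nil => simp [monomialValue]
  | cons x w ih =>
    refine Eq.trans ?_ (Fin.prod_univ_succ (n := w.length) _).symm
    rw [monomialValue, ih, mul_comm (divPow (v 0) x.1)]
    rfl

theorem conjValue_eq (w : Word) (s : ℚ) (u v : ℕ → ℚ) : conjValue s w u v =
    ∏ j ∈ Finset.range w.length, divPow (s + ∑ i ∈ Finset.range (j + 1), v i) (w.getD j 0).2 *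
      divPow (u j - u (j + 1)) (w.getD j 0).1 := by
  induction w generalizing s u v with
  | nil => simp [conjValue]
  | cons x w ih =>
    rw [conjValue, ih, List.length_cons, Finset.prod_range_succ', mul_comm]
    congr 1
    · refine Finset.prod_congr rfl fun j _ => ?_
      rw [List.getD_cons_succ, Finset.sum_range_succ' _ (j + 1)]
      congr 2
      ring
    · simp

/-- The extension of a tuple by zeros. -/
def extend {l : ℕ} (u : Fin l → ℕ) (i : ℕ) : ℕ := if h : i < l then u ⟨i, h⟩ else 0

theorem extend_val {l : ℕ} (u : Fin l → ℕ) (j : Fin l) : extend u j = u j := by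
  simp [extend]

theorem extend_of_le {l : ℕ} (u : Fin l → ℕ) {i : ℕ} (h : l ≤ i) : extend u i = 0 := by
  simp [extend, h]

/-- Conjugation of a partition: `p.1` is the tuple of parts and `p.2` the tuple of their
multiplicities. -/
def conj {l : ℕ} (p : (Fin l → ℕ) × (Fin l → ℕ)) : (Fin l → ℕ) × (Fin l → ℕ) :=
  (fun j => ∑ i ∈ Finset.range (l - j), extend p.2 i,
    fun j => extend p.1 (l - 1 - j) - extend p.1 (l - j))

theorem extend_conj_fst {l : ℕ} (p : (Fin l → ℕ) × (Fin l → ℕ)) (k : ℕ) :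
    extend (conj p).1 k = ∑ i ∈ Finset.range (l - k), extend p.2 i := by
  by_cases h : k < l
  · simp [extend, conj, h]
  · rw [extend_of_le _ (not_lt.1 h), Nat.sub_eq_zero_of_le (not_lt.1 h)]; simp

theorem extend_conj_snd {l : ℕ} (p : (Fin l → ℕ) × (Fin l → ℕ)) {k : ℕ} (hk : k < l) :
    extend (conj p).2 k = extend p.1 (l - 1 - k) - extend p.1 (l - k) :=
  extend_val (conj p).2 ⟨k, hk⟩

theorem extend_succ_lt {l : ℕ} {u : Fin l → ℕ} (hu : StrictAnti u) (h0 : ∀ j, 0 < u j) {i : ℕ}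
    (hi : i < l) : extend u (i + 1) < extend u i := by
  by_cases h : i + 1 < l
  · simp only [extend, hi, h, dif_pos]
    exact hu (Nat.lt_succ_self i)
  · rw [extend_of_le _ (not_lt.1 h)]
    simpa [extend, hi] using h0 ⟨i, hi⟩

theorem sum_partial_mul_sub (u v : ℕ → ℤ) (l : ℕ) :
    ∑ k ∈ Finset.range l, (∑ i ∈ Finset.range (k + 1), v i) * (u k - u (k + 1)) =
      ∑ k ∈ Finset.range l, u k * v k - (∑ i ∈ Finset.range l, v i) * u l := by
  induction l with
  | zero => simp
  | succ l ih =>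
    rw [Finset.sum_range_succ, ih, Finset.sum_range_succ _ l, Finset.sum_range_succ _ l]
    ring

theorem conj_mem {l n : ℕ} {p : (Fin l → ℕ) × (Fin l → ℕ)} (hp : p ∈ biIndex l n) :
    conj p ∈ biIndex l n := by
  obtain ⟨hu, hu0, hv0, hn⟩ := (mem_biIndex p).1 hp
  have hpos : ∀ i < l, 0 < extend p.2 i := fun i hi => by
    simpa [extend, hi] using hv0 ⟨i, hi⟩
  rw [mem_biIndex]
  refine ⟨fun i j hij => ?_, fun j => ?_, fun j => ?_, ?_⟩
  · have hij : (i : ℕ) < j := hij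
    have hj := j.2
    change ∑ k ∈ Finset.range (l - j), extend p.2 k < ∑ k ∈ Finset.range (l - i), extend p.2 k
    refine Finset.sum_lt_sum_of_subset (i := l - 1 - i) ?_ ?_ ?_ (hpos _ (by omega)) ?_
    · exact Finset.range_subset_range.2 (by omega)
    · simp; omega
    · simp; omega
    · intros; exact Nat.zero_le _
  · have hj := j.2
    change 0 < ∑ k ∈ Finset.range (l - j), extend p.2 k
    refine Finset.sum_pos (fun i hi => hpos i ?_) ⟨0, Finset.mem_range.2 (by omega)⟩
    have := Finset.mem_range.1 hi
    omega
  · have hj := j.2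
    have := extend_succ_lt hu hu0 (i := l - 1 - j) (by omega)
    rw [show l - 1 - (j : ℕ) + 1 = l - j by omega] at this
    exact Nat.sub_pos_of_lt this
  · have h1 : ∑ j, (conj p).1 j * (conj p).2 j = ∑ k ∈ Finset.range l,
        (∑ i ∈ Finset.range (k + 1), extend p.2 i) * (extend p.1 k - extend p.1 (k + 1)) := by
      rw [← Finset.sum_range_reflect, Finset.sum_range]
      refine Finset.sum_congr rfl fun j _ => ?_
      have hj := j.2
      rw [show l - 1 - (j : ℕ) + 1 = l - j by omega]
      rfl
    have h2 : ∑ j, p.1 j * p.2 j = ∑ k ∈ Finset.range l, extend p.1 k * extend p.2 k := by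
      rw [Finset.sum_range]
      exact Finset.sum_congr rfl fun j _ => by rw [extend_val, extend_val]
    rw [h1, ← hn, h2]
    zify
    have h3 := sum_partial_mul_sub (fun k => extend p.1 k) (fun k => extend p.2 k) l
    rw [extend_of_le p.1 le_rfl, Nat.cast_zero, mul_zero, sub_zero] at h3
    rw [← h3]
    refine Finset.sum_congr rfl fun k hk => ?_
    rw [Nat.cast_sub (extend_succ_lt hu hu0 (Finset.mem_range.1 hk)).le]

theorem conj_conj {l n : ℕ} {p : (Fin l → ℕ) × (Fin l → ℕ)} (hp : p ∈ biIndex l n) :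
    conj (conj p) = p := by
  obtain ⟨hu, hu0, hv0, hn⟩ := (mem_biIndex p).1 hp
  refine Prod.ext (funext fun j => ?_) (funext fun j => ?_)
  · have hj := j.2
    have key : ∀ m ≤ l, ∑ i ∈ Finset.range m, extend (conj p).2 i = extend p.1 (l - m) := by
      intro m
      induction m with
      | zero => intro _; simp [extend_of_le]
      | succ m ih =>
        intro hm
        rw [Finset.sum_range_succ, ih (by omega), extend_conj_snd p (by omega)]
        have := extend_succ_lt hu hu0 (i := l - (m + 1)) (by omega)
        rw [show l - (m + 1) + 1 = l - m by omega] at this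
        rw [show l - 1 - m = l - (m + 1) by omega]
        omega
    change ∑ i ∈ Finset.range (l - j), extend (conj p).2 i = _
    rw [key _ (Nat.sub_le _ _), Nat.sub_sub_self hj.le, extend_val]
  · have hj := j.2
    change extend (conj p).1 (l - 1 - j) - extend (conj p).1 (l - j) = _
    rw [extend_conj_fst, extend_conj_fst, show l - (l - 1 - j) = j + 1 by omega,
      Nat.sub_sub_self hj.le, Finset.sum_range_succ, Nat.add_sub_cancel_left, extend_val]

theorem wordTerm_conj {w : Word} {n : ℕ} {p : (Fin w.length → ℕ) × (Fin w.length → ℕ)}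
    (hp : p ∈ biIndex w.length n) : wordTerm w (conj p).1 (conj p).2 =
      conjValue 0 w.reverse (fun i => extend p.1 i) fun i => extend p.2 i := by
  obtain ⟨hu, hu0, _, _⟩ := (mem_biIndex p).1 hp
  rw [conjValue_eq, List.length_reverse, ← Finset.prod_range_reflect, Finset.prod_range]
  refine Finset.prod_congr rfl fun j _ => ?_
  have hj := j.2
  have h1 : w.reverse.getD (w.length - 1 - j) 0 = w.get j := by
    rw [List.getD_eq_getElem _ _ (by simp; omega), List.getElem_reverse, List.get_eq_getElem]
    congr 1
    omega
  have h2 := extend_succ_lt hu hu0 (i := w.length - 1 - j) (by omega)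
  rw [show w.length - 1 - (j : ℕ) + 1 = w.length - j by omega] at h2
  rw [h1, show w.length - 1 - (j : ℕ) + 1 = w.length - j by omega, zero_add, ← Nat.cast_sum,
    ← Nat.cast_sub h2.le]
  rfl

/-- Conjugation of partitions expresses the bi-bracket of `w` by the bi-brackets in `dual w`. -/
theorem biSeries_eq_sum_dual (w : Word) :
    biSeries w = ((dual w).map fun x => x.1 • biSeries x.2).sum := by
  ext n
  have h1 : coeff n (biSeries w) =
      ∑ p ∈ biIndex w.length n, wordTerm w (conj p).1 (conj p).2 := by
    rw [coeff_biSeries]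
    refine (Finset.sum_nbij' conj conj (fun _ => conj_mem) (fun _ => conj_mem)
      (fun _ => conj_conj) (fun _ => conj_conj) fun _ _ => rfl).symm
  have h2 : ∀ x ∈ dual w, coeff n (x.1 • biSeries x.2) = ∑ p ∈ biIndex w.length n,
      (x.1 : ℚ) * monomialValue x.2 (fun i => extend p.1 i) fun i => extend p.2 i := by
    intro x hx
    rw [map_zsmul, coeff_biSeries, zsmul_eq_mul, Finset.mul_sum, ← (wt_of_mem_dual hx).1]
    refine Finset.sum_congr rfl fun p _ => ?_
    rw [monomialValue_eq]
    simp only [extend_val]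
    rfl
  rw [h1, map_list_sum, List.map_map,
    show (dual w).map (coeff n ∘ fun x => x.1 • biSeries x.2) = _ from List.map_congr_left h2]
  have h3 : ∀ L : List (ℤ × Word), (L.map fun x : ℤ × Word => ∑ p ∈ biIndex w.length n,
      (x.1 : ℚ) * monomialValue x.2 (fun i => extend p.1 i) fun i => extend p.2 i).sum =
      ∑ p ∈ biIndex w.length n, (L.map fun x : ℤ × Word =>
        (x.1 : ℚ) * monomialValue x.2 (fun i => extend p.1 i) fun i => extend p.2 i).sum := by
    intro L
    induction L with
    | nil => simp
    | cons x L ih => simp [ih, Finset.sum_add_distrib]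
  rw [h3]
  refine Finset.sum_congr rfl fun p hp => ?_
  rw [wordTerm_conj hp, dual_value]
  simp [extend_of_le]

/-! ### Generators in weight at most seven -/

/-- The four words with `s ∈ {1, 2, 3}` that are left out of the generators: in the notation with
`s = m + 1` these are `(2, 2, 2)`, `(2, 2, 3)`, `(1, 2, 2, 2)` and `(2, 2, 2, 1)`. -/
def exceptional : List Word :=
  [[(1, 0), (1, 0), (1, 0)], [(1, 0), (1, 0), (2, 0)], [(0, 0), (1, 0), (1, 0), (1, 0)],
    [(1, 0), (1, 0), (1, 0), (0, 0)]]

/-- The words of 123-brackets, apart from the exceptional ones. -/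
def isBasic (w : Word) : Bool :=
  w.all (fun x => Nat.ble x.1 2 && Nat.beq x.2 0) && !exceptional.contains w

/-- The words of weight `j` whose bi-brackets are multiplied with duality relations. -/
def multipliers : ℕ → List Word
  | 0 => [[]]
  | 1 => [[(0, 0)]]
  | 2 => [[(1, 0)], [(0, 1)]]
  | 3 => [[(0, 0), (1, 0)], [(0, 0), (0, 1)], [(1, 0), (0, 0)], [(0, 1), (0, 0)]]
  | _ => []

/-- The sum of the exponents `s - 1`. -/
def vDegree (w : Word) : ℕ := w.foldl (fun n x => Nat.add n x.1) 0

/-- The sum of the exponents `r`. -/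
def uDegree (w : Word) : ℕ := w.foldl (fun n x => Nat.add n x.2) 0

/-- Inserts the relations `(d - a) * b` into the tree, where `d` is the dual of `a` and `b` runs
through a list. The coordinates outside the mask `M` are dropped. -/
def insertRelations (M : ℕ) (a : Word) (d : List (ℤ × Word)) :
    List Word → PivotTree → (PivotTree → Bool) → Bool
  | [], L, f => f L
  | b :: bs, L, f => addStuffle a b 2 0 0 0 fun A B => addStuffleSum b d A B fun A B =>
      force (Nat.land A M) fun A => force (Nat.land B M) fun B =>
        insertRow L (fun L => insertRelations M a d bs L f) 1000 A B

/-- Inserts the relations for all words `a` in a list. As duality is an involution that exchanges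
the two degrees, the words with `uDegree a ≤ vDegree a` suffice. -/
def echelonAux (M : ℕ) (bs : List Word) : List Word → PivotTree → (PivotTree → Bool) → Bool
  | [], L, f => f L
  | a :: as, L, f =>
    bif Nat.ble (uDegree a) (vDegree a) then
      insertRelations M a (dual a) bs L fun L => echelonAux M bs as L f
    else echelonAux M bs as L f

/-- Inserts all relations of weight `k` with a multiplier of weight less than `j`. -/
def echelonFrom (M k : ℕ) : ℕ → PivotTree → (PivotTree → Bool) → Bool
  | 0, L, f => f L
  | j + 1, L, f => bif Nat.ble j k then
      echelonFrom M k j L fun L => echelonAux M (multipliers j) (words (Nat.sub k j)) L f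
    else echelonFrom M k j L f

/-- Adds the coordinates of those words of a list that are not basic to the mask `n`. Initially `n`
contains the positions below `64`, so that the checksums are kept. -/
def mask : List Word → ℕ → (ℕ → Bool) → Bool
  | [], n, f => f n
  | w :: ws, n, f => bif isBasic w then mask ws n f else
    force (Nat.lor n (unitRow (code w))) fun n => mask ws n f

/-- Whether the relations of weight `k` express every word modulo `3` by the basic words. -/
def check (k : ℕ) : Bool :=
  mask (words k) (2 ^ 64 - 1) fun M => echelonFrom M k 4 .empty fun L =>
    (words k).all fun w => isBasic w ||
      force (Nat.add 64 (code w)) fun c => hasPivot c shifts c L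

theorem wt_of_mem_multipliers {j : ℕ} {b : Word} (h : b ∈ multipliers j) : wt b = j := by
  match j with
  | 0 | 1 | 2 | 3 => revert b; decide
  | j + 4 => simp [multipliers] at h

theorem testBit_mask {ws : List Word} {n : ℕ} {f : ℕ → Bool} (h : mask ws n f = true) :
    ∃ M, (∀ i, n.testBit i = true → M.testBit i = true) ∧
      (∀ w ∈ ws, isBasic w = false → M.testBit (64 + code w) = true) ∧ f M = true := by
  induction ws generalizing n with
  | nil => exact ⟨n, fun _ h => h, by simp, h⟩
  | cons w ws ih =>
    rw [mask, Bool.cond_eq_ite] at h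
    split_ifs at h with hw
    · obtain ⟨M, h1, h2, h3⟩ := ih h
      exact ⟨M, h1, by simpa [hw] using h2, h3⟩
    · rw [force_eq] at h
      obtain ⟨M, h1, h2, h3⟩ := ih h
      have h4 : ∀ i, (Nat.lor n (unitRow (code w))).testBit i =
        (n.testBit i || (unitRow (code w)).testBit i) := fun i => Nat.testBit_or _ _ _
      refine ⟨M, fun i hi => h1 i (by rw [h4, hi, Bool.true_or]), ?_, h3⟩
      intro v hv hv'
      rcases List.mem_cons.1 hv with rfl | hv
      · exact h1 _ (by rw [h4, testBit_unitRow]; simp)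
      · exact h2 v hv hv'

section Elimination

variable {Q : Type*} [AddCommGroup Q] {y : Word → Q} {k : ℕ}

theorem isRowSpace_eval (hy : ∀ w, wt w = k → (3 : ℤ) • y w = 0) :
    IsRowSpace fun a b => Reduced a b ∧ eval y k a b = 0 where
  sum h h' := ⟨h.1.sum h'.1, by rw [eval_sum hy h.1 h'.1, h.2, h'.2, add_zero]⟩
  swap h := ⟨h.1.symm, by rw [eval_swap, h.2, neg_zero]⟩

theorem Reduced.land {a b : ℕ} (h : Reduced a b) (M : ℕ) :
    Reduced (Nat.land a M) (Nat.land b M) := by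
  intro i hi
  change ((HAnd.hAnd a M).testBit i = true ∧ (HAnd.hAnd b M).testBit i = true) at hi
  rw [Nat.testBit_and, Nat.testBit_and, Bool.and_eq_true, Bool.and_eq_true] at hi
  exact h i ⟨hi.1.1, hi.2.1⟩

/-- The coordinates outside the mask belong to words with the value `0`. -/
theorem eval_land {M : ℕ} (hM : ∀ w, wt w = k → M.testBit (64 + code w) = false → y w = 0)
    (a b : ℕ) : eval y k (Nat.land a M) (Nat.land b M) = eval y k a b := by
  refine Finset.sum_congr rfl fun w hw => ?_
  cases hw' : M.testBit (64 + code w) with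
  | true => simp [entry, hw']
  | false => rw [hM w (mem_words.1 (List.mem_toFinset.1 hw)) hw', smul_zero, smul_zero]

theorem insertRelations_spec (hy : ∀ w, wt w = k → (3 : ℤ) • y w = 0) {M : ℕ}
    (hM : ∀ w, wt w = k → M.testBit (64 + code w) = false → y w = 0) {a : Word}
    {d : List (ℤ × Word)} (hd : ∀ x ∈ d, wt x.2 = wt a) {f : PivotTree → Bool} {bs : List Word}
    (hbs : ∀ b ∈ bs, wt a + wt b = k ∧
      (d.map fun x => x.1 • stuffleSum y x.2 b).sum + 2 • stuffleSum y a b = 0)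
    {L : PivotTree} (hL : L.All fun a b => Reduced a b ∧ eval y k a b = 0)
    (h : insertRelations M a d bs L f = true) :
    ∃ L' : PivotTree, (L'.All fun a b => Reduced a b ∧ eval y k a b = 0) ∧ f L' = true := by
  induction bs generalizing L with
  | nil => exact ⟨L, hL, h⟩
  | cons b bs ih =>
    rw [insertRelations] at h
    obtain ⟨hk, hrel⟩ := hbs b List.mem_cons_self
    obtain ⟨A₁, B₁, h₁, e₁, h⟩ := addStuffle_spec hy [] a b (by simpa using hk) (reduced_zero 0) h
    obtain ⟨A₂, B₂, h₂, e₂, h⟩ :=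
      addStuffleSum_spec hy b d (fun x hx => by rw [hd x hx, hk]) h₁ h
    rw [force_eq, force_eq] at h
    obtain ⟨L', hL', h⟩ := insertRow_spec (isRowSpace_eval hy) hL
      ⟨h₂.land M, by
        rw [eval_land hM, e₂, e₁, eval_zero, zero_add, add_comm]; exact hrel⟩ h
    exact ih (fun b hb => hbs b (List.mem_cons_of_mem _ hb)) hL' h

theorem echelonAux_spec (hy : ∀ w, wt w = k → (3 : ℤ) • y w = 0) {M : ℕ}
    (hM : ∀ w, wt w = k → M.testBit (64 + code w) = false → y w = 0)
    (hrel : ∀ a b, wt a + wt b = k →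
      ((dual a).map fun x => x.1 • stuffleSum y x.2 b).sum + 2 • stuffleSum y a b = 0)
    {f : PivotTree → Bool} {as bs : List Word} (hab : ∀ a ∈ as, ∀ b ∈ bs, wt a + wt b = k)
    {L : PivotTree} (hL : L.All fun a b => Reduced a b ∧ eval y k a b = 0)
    (h : echelonAux M bs as L f = true) :
    ∃ L' : PivotTree, (L'.All fun a b => Reduced a b ∧ eval y k a b = 0) ∧ f L' = true := by
  induction as generalizing L with
  | nil => exact ⟨L, hL, h⟩
  | cons a as ih =>
    have ih := @ih fun a ha => hab a (List.mem_cons_of_mem _ ha)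
    rw [echelonAux, Bool.cond_eq_ite] at h
    split_ifs at h
    · obtain ⟨L', hL', h⟩ := insertRelations_spec hy hM (fun x hx => (wt_of_mem_dual hx).2)
        (fun b hb => ⟨hab a List.mem_cons_self b hb, hrel a b (hab a List.mem_cons_self b hb)⟩) hL h
      exact ih hL' h
    · exact ih hL h

theorem echelonFrom_spec (hy : ∀ w, wt w = k → (3 : ℤ) • y w = 0) {M : ℕ}
    (hM : ∀ w, wt w = k → M.testBit (64 + code w) = false → y w = 0)
    (hrel : ∀ a b, wt a + wt b = k →
      ((dual a).map fun x => x.1 • stuffleSum y x.2 b).sum + 2 • stuffleSum y a b = 0)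
    {f : PivotTree → Bool} {j : ℕ}
    {L : PivotTree} (hL : L.All fun a b => Reduced a b ∧ eval y k a b = 0)
    (h : echelonFrom M k j L f = true) :
    ∃ L' : PivotTree, (L'.All fun a b => Reduced a b ∧ eval y k a b = 0) ∧ f L' = true := by
  induction j generalizing f with
  | zero => exact ⟨L, hL, h⟩
  | succ j ih =>
    rw [echelonFrom, Bool.cond_eq_ite] at h
    split_ifs at h with hj
    · obtain ⟨L', hL', h⟩ := ih h
      refine echelonAux_spec hy hM hrel (fun a ha b hb => ?_) hL' h
      rw [mem_words.1 ha, wt_of_mem_multipliers hb]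
      exact Nat.sub_add_cancel (Nat.le_of_ble_eq_true hj)
    · exact ih h

/-- If the relations hold for `y` and the basic words have the value `0`, then a pivot at the
position of `w` expresses `y w` by the values of words with smaller codes. -/
theorem eq_zero_of_check (hy : ∀ w, wt w = k → (3 : ℤ) • y w = 0)
    (hbasic : ∀ w, wt w = k → isBasic w = true → y w = 0)
    (hrel : ∀ a b, wt a + wt b = k →
      ((dual a).map fun x => x.1 • stuffleSum y x.2 b).sum + 2 • stuffleSum y a b = 0)
    (h : check k = true) (w : Word) (hw : wt w = k) : y w = 0 := by
  obtain ⟨M, -, hM, h⟩ := testBit_mask h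
  have hM : ∀ w, wt w = k → M.testBit (64 + code w) = false → y w = 0 := by
    intro w hw h
    refine hbasic w hw ?_
    by_contra hb
    rw [hM w (mem_words.2 hw) (by simpa using hb)] at h
    exact Bool.noConfusion h
  obtain ⟨L, hL, h⟩ := echelonFrom_spec hy hM hrel (L := .empty) trivial h
  generalize hc : code w = c
  induction c using Nat.strong_induction_on generalizing w with
  | _ c ih =>
  have hw' := List.all_eq_true.1 h w (mem_words.2 hw)
  rcases Bool.or_eq_true_iff.1 hw' with hb | hp
  · exact hbasic w hw hb
  rw [force_eq] at hp
  obtain ⟨a, b, ⟨-, he⟩, hone, hlt⟩ := hasPivot_spec And.left hL hp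
  have hsum : eval y k a b = entry a b (64 + code w) • y w := by
    refine Finset.sum_eq_single w (fun v hv hvw => ?_)
      fun hv => absurd (List.mem_toFinset.2 (mem_words.2 hw)) hv
    rcases lt_trichotomy (code v) (code w) with hlt' | heq | hgt
    · rw [ih _ (hc ▸ hlt') v (mem_words.1 (List.mem_toFinset.1 hv)) rfl, smul_zero]
    · exact absurd (code_injective heq) hvw
    · rw [hlt _ (show 64 + code w < 64 + code v by omega), zero_smul]
  rw [hsum] at he
  rcases hone with hone | hone <;> rw [show entry a b (64 + code w) = _ from hone] at he
  · simpa using he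
  · simpa using he

end Elimination

/-- The span of the bi-brackets of the basic words of weight `k`. -/
def basicSpan (k : ℕ) : Submodule ℚ (PowerSeries ℚ) :=
  Submodule.span ℚ {f | ∃ w, wt w = k ∧ isBasic w = true ∧ f = biSeries w}

/-- The relations modulo `3` suffice over `ℚ`: by Nakayama's lemma, the bi-brackets of weight `k`
span a finitely generated abelian group, modulo lower weight and basic words, that is killed by an
integer which is `1` modulo `3`. -/
theorem biSeries_mem_of_check {k : ℕ} (h : check k = true) {w : Word} (hw : wt w = k) :
    biSeries w ∈ biSpan k ⊔ basicSpan k := by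
  set N : Submodule ℚ (PowerSeries ℚ) := biSpan k ⊔ basicSpan k with hN
  let z : Word → PowerSeries ℚ ⧸ N := fun w => N.mkQ (biSeries w)
  let L : Submodule ℤ (PowerSeries ℚ ⧸ N) := Submodule.span ℤ (z '' {w | w ∈ words k})
  let I : Ideal ℤ := Ideal.span {3}
  have hzL : ∀ w, wt w = k → z w ∈ L := fun w hw =>
    Submodule.subset_span ⟨w, mem_words.2 hw, rfl⟩
  let y : Word → (PowerSeries ℚ ⧸ N) ⧸ I • L := fun w => (I • L).mkQ (z w)
  have hy : ∀ w, wt w = k → (3 : ℤ) • y w = 0 := fun w hw => by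
    rw [← map_smul, Submodule.mkQ_apply, Submodule.Quotient.mk_eq_zero]
    exact Submodule.smul_mem_smul (Ideal.mem_span_singleton_self 3) (hzL w hw)
  have hbasic : ∀ w, wt w = k → isBasic w = true → y w = 0 := fun w hw hb => by
    have : z w = 0 := (Submodule.Quotient.mk_eq_zero N).2
      (Submodule.mem_sup_right (Submodule.subset_span ⟨w, hw, hb, rfl⟩))
    rw [show y w = (I • L).mkQ (z w) from rfl, this, map_zero]
  have hmul : ∀ a b, wt a + wt b = k → N.mkQ (biSeries a * biSeries b) = stuffleSum z a b := by
    intro a b hab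
    rw [← sub_eq_zero]
    have h1 := map_stuffleSum N.mkQ.toAddMonoidHom biSeries a b
    have h2 := biSeries_mul a b
    rw [hab] at h2
    have h3 : N.mkQ (biSeries a * biSeries b - stuffleSum biSeries a b) = 0 := by
      rw [Submodule.mkQ_apply, Submodule.Quotient.mk_eq_zero, hN]
      exact Submodule.mem_sup_left h2
    rw [map_sub] at h3
    exact h1 ▸ h3
  have hrel : ∀ a b, wt a + wt b = k →
      ((dual a).map fun x => x.1 • stuffleSum y x.2 b).sum + 2 • stuffleSum y a b = 0 := by
    intro a b hab
    have h1 : ((dual a).map fun x => x.1 • stuffleSum z x.2 b).sum = stuffleSum z a b := by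
      rw [← hmul a b hab]
      conv_rhs => rw [biSeries_eq_sum_dual a, ← List.sum_map_mul_right, map_list_sum, List.map_map]
      refine congrArg List.sum (List.map_congr_left fun x hx => ?_)
      rw [← hmul x.2 b (by rw [(wt_of_mem_dual hx).2, hab]), Function.comp_apply, smul_mul_assoc,
        map_zsmul]
    have h2 : ∀ a, stuffleSum y a b = (I • L).mkQ (stuffleSum z a b) := fun a =>
      (map_stuffleSum (I • L).mkQ.toAddMonoidHom z a b).symm
    have h3 : ((dual a).map fun x => x.1 • stuffleSum y x.2 b).sum = stuffleSum y a b := by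
      rw [h2 a, ← h1, map_list_sum, List.map_map]
      refine congrArg List.sum (List.map_congr_left fun x hx => ?_)
      rw [h2, Function.comp_apply, map_smul]
    rw [h3]
    let K : AddSubgroup ((PowerSeries ℚ ⧸ N) ⧸ I • L) := (zsmulAddGroupHom (3 : ℤ)).ker
    have h4 : (3 : ℤ) • stuffleSum y a b = 0 := by
      refine stuffleSum_mem (N := K.toAddSubmonoid) _ _ _ fun w hw => ?_
      exact hy _ (hw.trans hab)
    rw [← h4, show (3 : ℤ) = 1 + 2 from rfl, add_smul, one_smul, ← natCast_zsmul]
    rfl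
  have hle : L ≤ I • L := by
    refine Submodule.span_le.2 ?_
    rintro _ ⟨w, hw, rfl⟩
    have := eq_zero_of_check hy hbasic hrel h w (mem_words.1 hw)
    rwa [show y w = (I • L).mkQ (z w) from rfl, Submodule.mkQ_apply,
      Submodule.Quotient.mk_eq_zero] at this
  have hfg : L.FG := Submodule.fg_span ((List.finite_toSet (words k)).image z)
  obtain ⟨r, hr, hkill⟩ :=
    Submodule.exists_sub_one_mem_and_smul_eq_zero_of_fg_of_le_smul I L hfg hle
  have hr0 : r ≠ 0 := by
    rintro rfl
    obtain ⟨c, hc⟩ := Ideal.mem_span_singleton.1 hr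
    omega
  have hz := hkill _ (hzL w hw)
  rw [← Int.cast_smul_eq_zsmul ℚ] at hz
  exact (Submodule.Quotient.mk_eq_zero N).1
    ((smul_eq_zero.1 hz).resolve_left (by exact_mod_cast hr0))

theorem check_eq_true {k : ℕ} (hk : k ≤ 7) : check k = true := by
  have h0 : check 0 = true := by decide +kernel
  have h1 : check 1 = true := by decide +kernel
  have h2 : check 2 = true := by decide +kernel
  have h3 : check 3 = true := by decide +kernel
  have h4 : check 4 = true := by decide +kernel
  have h5 : check 5 = true := by decide +kernel
  have h6 : check 6 = true := by decide +kernel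
  have h7 : check 7 = true := by decide +kernel
  interval_cases k
  exacts [h0, h1, h2, h3, h4, h5, h6, h7]

/-! ### Independence modulo three -/

/-- Adds the product of a series with `∑ v ^ m * q ^ (u * v)` to the series `(A, B)`. Series are
stored as vectors of coefficients up to `q ^ 92`. The sum is over `n` consecutive values of `v`, of
which `v` is the first, and `(a, b)` is the series shifted by `u * (v - 1)`. -/
def addMultiples (m u : ℕ) : ℕ → ℕ → ℕ → ℕ → ℕ → ℕ → (ℕ → ℕ → Bool) → Bool
  | 0, _, _, _, A, B, f => f A B
  | n + 1, v, a, b, A, B, f =>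
    force (Nat.mod (Nat.shiftLeft a u) (2 ^ 93)) fun a =>
      force (Nat.mod (Nat.shiftLeft b u) (2 ^ 93)) fun b =>
        force (Nat.succ v) fun v' =>
          force (Nat.mod (Nat.pow v m) 3) fun c =>
            bif Nat.beq c 0 then addMultiples m u n v' a b A B f
            else bif Nat.beq c 1 then
              addRow A B a b fun A B => addMultiples m u n v' a b A B f
            else addRow A B b a fun A B => addMultiples m u n v' a b A B f

/-- Computes the truncated sums of a word from those of the word without its first letter `m`. -/
def consRows (m : ℕ) : List (ℕ × ℕ) → ℕ → ℕ → ℕ → (List (ℕ × ℕ) → ℕ → ℕ → Bool) → Bool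
  | [], _, A, B, f => f [] A B
  | x :: L, i, A, B, f => force (Nat.succ i) fun i' => force (Nat.div 92 i') fun n =>
    addMultiples m i' n 1 x.1 x.2 A B fun A' B' =>
      consRows m L i' A' B' fun L' => f ((A, B) :: L')

/-- Moves the vector of coefficients to the positions from `64` on, and inserts it. -/
def insertSeries (T : PivotTree) (f : PivotTree → Bool) (a b : ℕ) : Bool :=
  force (Nat.lor (Nat.shiftLeft a 64) (Nat.mod a (2 ^ 64))) fun a =>
    force (Nat.lor (Nat.shiftLeft b 64) (Nat.mod b (2 ^ 64))) fun b =>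
      insertRow T f 1000 a b

/-- The part of `searchWords` for the first letter `m`. -/
def searchLetter (F : ℕ → List (ℕ × ℕ) → PivotTree → (PivotTree → Bool) → Bool)
    (m n : ℕ) (L : List (ℕ × ℕ)) (T : PivotTree) (f : PivotTree → Bool) : Bool :=
  bif Nat.ble m n then
    consRows m L 0 0 0 fun L A B => insertSeries T (fun T => F (Nat.sub n m) L T f) A B
  else f T

/-- Inserts the series of all words that extend a given word to the left, by letters `m ≤ 2` of
total weight at most `n`, where at most `d` letters are added. The list `L` holds the truncated
sums of the given word for `N < 92`. -/
def searchWords : ℕ → ℕ → List (ℕ × ℕ) → PivotTree → (PivotTree → Bool) → Bool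
  | 0, _, _, T, f => f T
  | _ + 1, 0, _, T, f => f T
  | d + 1, n + 1, L, T, f => searchLetter (searchWords d) 0 n L T fun T =>
      searchLetter (searchWords d) 1 n L T fun T => searchLetter (searchWords d) 2 n L T f

/-- Whether combinations of the 123-brackets of weight at most `7` have leading terms modulo `3` in
all degrees up to `92` except `1`, where the leading term is the one of highest degree below
`93`. -/
def checkRank : Bool :=
  insertSeries .empty (fun T => searchWords 7 7 (List.replicate 92 (1, 0)) T fun T =>
    (List.range 93).all fun i => Nat.beq i 1 ||
      force (Nat.add 64 i) fun i => hasPivot i shifts i T) 1 0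

/-- The vector `(a, b)` gives the coefficients of `g` up to `q ^ 92`, modulo `3`. -/
def Represents (a b : ℕ) (g : PowerSeries ℚ) : Prop :=
  Reduced a b ∧ ∀ i < 93, ∃ n : ℤ, coeff i g = n ∧ entry a b i ≡ n [ZMOD 3]

theorem Represents.congr {a b : ℕ} {g h : PowerSeries ℚ} (hg : Represents a b g)
    (hgh : ∀ i < 93, coeff i h = coeff i g) : Represents a b h :=
  ⟨hg.1, fun i hi => by rw [hgh i hi]; exact hg.2 i hi⟩

theorem represents_zero : Represents 0 0 0 :=
  ⟨reduced_zero 0, fun i _ => ⟨0, by simp, by simp [entry]⟩⟩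

theorem represents_one : Represents 1 0 1 := by
  refine ⟨reduced_zero 1, fun i _ => ⟨if i = 0 then 1 else 0, ?_, ?_⟩⟩
  · rw [coeff_one]; split_ifs <;> simp
  · rcases i with _ | i
    · simp [entry]
    · have : Nat.testBit 1 (i + 1) = false := by rw [Nat.testBit_succ]; simp
      simp [entry, this]

theorem Represents.add_smul {A B a b : ℕ} {G g : PowerSeries ℚ} (hG : Represents A B G)
    (hg : Represents a b g) {c : ℕ} (hc : c % 3 = 1) :
    Represents (sumPos A B a b) (sumNeg A B a b) (G + (c : ℚ) • g) := by
  refine ⟨hG.1.sum hg.1, fun i hi => ?_⟩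
  obtain ⟨m, hm, hm'⟩ := hG.2 i hi
  obtain ⟨n, hn, hn'⟩ := hg.2 i hi
  refine ⟨m + c * n, by simp [hm, hn], (entry_sum hG.1 hg.1 i).trans (hm'.add ?_)⟩
  have hc : (c : ℤ) ≡ 1 [ZMOD 3] := by unfold Int.ModEq; omega
  simpa using hn'.trans (by simpa using (hc.mul_right n).symm)

theorem Represents.sub_smul {A B a b : ℕ} {G g : PowerSeries ℚ} (hG : Represents A B G)
    (hg : Represents a b g) {c : ℕ} (hc : c % 3 = 2) :
    Represents (sumPos A B b a) (sumNeg A B b a) (G + (c : ℚ) • g) := by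
  refine ⟨hG.1.sum hg.1.symm, fun i hi => ?_⟩
  obtain ⟨m, hm, hm'⟩ := hG.2 i hi
  obtain ⟨n, hn, hn'⟩ := hg.2 i hi
  refine ⟨m + c * n, by simp [hm, hn], (entry_sum hG.1 hg.1.symm i).trans (hm'.add ?_)⟩
  have hc : (c : ℤ) ≡ -1 [ZMOD 3] := by unfold Int.ModEq; omega
  rw [entry_swap a b]
  simpa using hn'.neg.trans (by simpa using (hc.mul_right n).symm)

theorem Represents.add_zero_smul {A B a b : ℕ} {G g : PowerSeries ℚ} (hG : Represents A B G)
    (hg : Represents a b g) {c : ℕ} (hc : c % 3 = 0) : Represents A B (G + (c : ℚ) • g) := by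
  refine ⟨hG.1, fun i hi => ?_⟩
  obtain ⟨m, hm, hm'⟩ := hG.2 i hi
  obtain ⟨n, hn, hn'⟩ := hg.2 i hi
  refine ⟨m + c * n, by simp [hm, hn], hm'.trans ?_⟩
  have hc : (c : ℤ) ≡ 0 [ZMOD 3] := by unfold Int.ModEq; omega
  simpa using ((hc.mul_right n).add_left m).symm

theorem Represents.shift {a b : ℕ} {g : PowerSeries ℚ} (hg : Represents a b g) (u : ℕ) :
    Represents (Nat.mod (Nat.shiftLeft a u) (2 ^ 93)) (Nat.mod (Nat.shiftLeft b u) (2 ^ 93))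
      (X ^ u * g) := by
  have h : ∀ a i, (Nat.mod (Nat.shiftLeft a u) (2 ^ 93)).testBit i =
      (decide (i < 93) && (decide (u ≤ i) && a.testBit (i - u))) := fun a i => by
    change ((a <<< u) % 2 ^ 93).testBit i = _
    rw [Nat.testBit_mod_two_pow, Nat.testBit_shiftLeft]
  refine ⟨fun i => ?_, fun i hi => ?_⟩
  · rw [h, h]
    have := hg.1 (i - u)
    simp only [Bool.and_eq_true]
    tauto
  · rw [coeff_X_pow_mul']
    split_ifs with hu
    · obtain ⟨n, hn, hn'⟩ := hg.2 (i - u) (by omega)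
      refine ⟨n, hn, ?_⟩
      rw [entry, h, h]
      simpa [hi, hu, entry] using hn'
    · refine ⟨0, by simp, ?_⟩
      rw [entry, h, h]
      simp [hu]

theorem addMultiples_spec {m u : ℕ} {g : PowerSeries ℚ} {f : ℕ → ℕ → Bool} {n v a b A B : ℕ}
    {G : PowerSeries ℚ} (hg : Represents a b (X ^ (u * v) * g)) (hG : Represents A B G)
    (h : addMultiples m u n (v + 1) a b A B f = true) :
    ∃ A' B', Represents A' B' (G + ∑ j ∈ Finset.range n,
      (((v + 1 + j) ^ m : ℕ) : ℚ) • (X ^ (u * (v + 1 + j)) * g)) ∧ f A' B' = true := by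
  induction n generalizing v a b A B G with
  | zero => exact ⟨A, B, by simpa using hG, h⟩
  | succ n ih =>
    rw [addMultiples] at h
    simp only [force_eq, Bool.cond_eq_ite, addRow_eq] at h
    have hg' := hg.shift u
    rw [← mul_assoc, ← pow_add, show u + u * v = u * (v + 1) by ring] at hg'
    have hsum : ∑ j ∈ Finset.range (n + 1),
        (((v + 1 + j) ^ m : ℕ) : ℚ) • (X ^ (u * (v + 1 + j)) * g) =
        (((v + 1) ^ m : ℕ) : ℚ) • (X ^ (u * (v + 1)) * g) + ∑ j ∈ Finset.range n,
          (((v + 1 + 1 + j) ^ m : ℕ) : ℚ) • (X ^ (u * (v + 1 + 1 + j)) * g) := by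
      rw [Finset.sum_range_succ', add_comm, add_zero]
      refine congrArg _ (Finset.sum_congr rfl fun j _ => ?_)
      rw [show v + 1 + (j + 1) = v + 1 + 1 + j by ring]
    rw [hsum, ← add_assoc]
    split_ifs at h with h0 h1
    · exact ih hg' (hG.add_zero_smul hg' (Nat.eq_of_beq_eq_true h0)) h
    · exact ih hg' (hG.add_smul hg' (Nat.eq_of_beq_eq_true h1)) h
    · refine ih hg' (hG.sub_smul hg' ?_) h
      have h0 : (v + 1) ^ m % 3 ≠ 0 := fun h => h0 (by rw [← Nat.beq_eq] at h; exact h)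
      have h1 : (v + 1) ^ m % 3 ≠ 1 := fun h => h1 (by rw [← Nat.beq_eq] at h; exact h)
      omega

/-- The truncated sum of the word with letters `(m, 0)`, without the factors `1 / m!`. -/
def intSum : List ℕ → ℕ → PowerSeries ℚ
  | [], _ => 1
  | m :: w, N => ∑ i ∈ Finset.range N, ((m.factorial : ℚ) • dilate m i) * intSum w i

theorem exists_intSum_eq (w : List ℕ) :
    ∃ c : ℚ, ∀ N, intSum w N = c • truncSum (w.map fun m => (m, 0)) N := by
  induction w with
  | nil => exact ⟨1, fun N => by simp [intSum, truncSum]⟩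
  | cons m w ih =>
    obtain ⟨c, hc⟩ := ih
    refine ⟨m.factorial * c, fun N => ?_⟩
    rw [List.map_cons, truncSum, consSum_apply, intSum, Finset.smul_sum]
    refine Finset.sum_congr rfl fun i _ => ?_
    rw [hc i, smul_mul_smul_comm]
    simp

theorem coeff_smul_dilate (m i : ℕ) {n : ℕ} (hn : n < 93) :
    coeff n ((m.factorial : ℚ) • dilate m i) = coeff n (∑ j ∈ Finset.range (92 / (i + 1)),
      (((j + 1) ^ m : ℕ) : ℚ) • (X : PowerSeries ℚ) ^ ((i + 1) * (j + 1))) := by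
  have hm : (m.factorial : ℚ) ≠ 0 := by exact_mod_cast m.factorial_ne_zero
  rw [map_smul, coeff_dilate, map_sum]
  simp only [map_smul, coeff_X_pow, smul_eq_mul]
  split_ifs with h
  · obtain ⟨⟨v, rfl⟩, h0⟩ := h
    obtain ⟨j, rfl⟩ : ∃ j, v = j + 1 := Nat.exists_eq_succ_of_ne_zero (by rintro rfl; simp at h0)
    rw [Nat.mul_div_cancel_left _ i.succ_pos, mul_div_cancel₀ _ hm, Finset.sum_eq_single j]
    · simp
    · intro b _ hb
      have : j ≠ b := fun h => hb h.symm
      simp [this]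
    · intro hj
      refine absurd (Finset.mem_range.2 ?_) hj
      have : j + 1 ≤ 92 / (i + 1) := (Nat.le_div_iff_mul_le i.succ_pos).2 <| by
        rw [mul_comm, Nat.succ_eq_add_one]; omega
      omega
  · rw [mul_zero, Finset.sum_eq_zero]
    intro j _
    rw [if_neg, mul_zero]
    rintro rfl
    exact h ⟨dvd_mul_right _ _, by positivity⟩

theorem coeff_mul_congr {f f' : PowerSeries ℚ} {N : ℕ} (h : ∀ i < N, coeff i f = coeff i f')
    (g : PowerSeries ℚ) {n : ℕ} (hn : n < N) : coeff n (f * g) = coeff n (f' * g) := by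
  rw [coeff_mul, coeff_mul]
  refine Finset.sum_congr rfl fun p hp => ?_
  rw [h p.1 (lt_of_le_of_lt (Finset.HasAntidiagonal.antidiagonal.fst_le hp) hn)]

/-- The list consists of the truncated sums of a word at `i`, `i + 1`, and so on. -/
def RowsFrom (w : List ℕ) : ℕ → List (ℕ × ℕ) → Prop
  | _, [] => True
  | i, x :: L => Represents x.1 x.2 (intSum w i) ∧ RowsFrom w (i + 1) L

theorem consRows_spec {m : ℕ} {w : List ℕ} {L : List (ℕ × ℕ)} {i A B : ℕ}
    {f : List (ℕ × ℕ) → ℕ → ℕ → Bool} (hL : RowsFrom w i L)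
    (hA : Represents A B (intSum (m :: w) i)) (h : consRows m L i A B f = true) :
    ∃ L' A' B', RowsFrom (m :: w) i L' ∧ L'.length = L.length ∧
      Represents A' B' (intSum (m :: w) (i + L.length)) ∧ f L' A' B' = true := by
  induction L generalizing i A B f with
  | nil => exact ⟨[], A, B, trivial, rfl, hA, h⟩
  | cons x L ih =>
    rw [consRows, force_eq, force_eq] at h
    obtain ⟨A₁, B₁, h₁, h⟩ := addMultiples_spec (v := 0) (g := intSum w i)
      (by simpa using hL.1) hA h
    have h₂ : Represents A₁ B₁ (intSum (m :: w) (i + 1)) := by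
      refine h₁.congr fun n hn => ?_
      rw [intSum, Finset.sum_range_succ, ← intSum, map_add, map_add,
        coeff_mul_congr (fun n hn => coeff_smul_dilate m i hn) _ hn, Finset.sum_mul]
      refine congrArg₂ _ rfl (congrArg _ (Finset.sum_congr rfl fun j _ => ?_))
      rw [smul_mul_assoc, zero_add, add_comm 1 j]
    obtain ⟨L', A', B', h₃, hlen, h₄, h⟩ := ih hL.2 h₂ h
    refine ⟨(A, B) :: L', A', B', ⟨hA, h₃⟩, by simp [hlen], ?_, h⟩
    rwa [List.length_cons, Nat.add_comm L.length, ← Nat.add_assoc]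

/-- The vectors whose entries from position `64` on are the coefficients modulo `3` of a
combination of bi-brackets of weight less than `k`. -/
def IsCoeffRow (k a b : ℕ) : Prop :=
  Reduced a b ∧ ∃ g ∈ biSpan k, ∀ i < 93, ∃ n : ℤ, coeff i g = n ∧ entry a b (64 + i) ≡ n [ZMOD 3]

theorem isRowSpace_isCoeffRow (k : ℕ) : IsRowSpace (IsCoeffRow k) where
  sum := by
    rintro a b c d ⟨h, g, hg, hi⟩ ⟨h', g', hg', hi'⟩
    refine ⟨h.sum h', g + g', Submodule.add_mem _ hg hg', fun i hi93 => ?_⟩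
    obtain ⟨m, hm, hm'⟩ := hi i hi93
    obtain ⟨n, hn, hn'⟩ := hi' i hi93
    exact ⟨m + n, by simp [hm, hn], (entry_sum h h' _).trans (hm'.add hn')⟩
  swap := by
    rintro a b ⟨h, g, hg, hi⟩
    refine ⟨h.symm, -g, Submodule.neg_mem _ hg, fun i hi93 => ?_⟩
    obtain ⟨m, hm, hm'⟩ := hi i hi93
    exact ⟨-m, by simp [hm], by rw [entry_swap a b]; exact hm'.neg⟩

theorem insertSeries_spec {k a b : ℕ} {T : PivotTree} {f : PivotTree → Bool}
    {g : PowerSeries ℚ} (hg : g ∈ biSpan k) (hab : Represents a b g) (hT : T.All (IsCoeffRow k))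
    (h : insertSeries T f a b = true) :
    ∃ T' : PivotTree, T'.All (IsCoeffRow k) ∧ f T' = true := by
  rw [insertSeries, force_eq, force_eq] at h
  have hbit : ∀ a i, (Nat.lor (Nat.shiftLeft a 64) (Nat.mod a (2 ^ 64))).testBit i =
      a.testBit (if 64 ≤ i then i - 64 else i) := fun a i => by
    change ((a <<< 64) ||| (a % 2 ^ 64)).testBit i = _
    rw [Nat.testBit_or, Nat.testBit_mod_two_pow, Nat.testBit_shiftLeft]
    split_ifs with hi
    · simp [hi, Nat.not_lt.2 hi]
    · simp [hi, Nat.lt_of_not_le hi]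
  refine insertRow_spec (isRowSpace_isCoeffRow k) hT ⟨fun i => ?_, g, hg, fun i hi => ?_⟩ h
  · rw [hbit, hbit]
    exact hab.1 _
  · obtain ⟨n, hn, hn'⟩ := hab.2 i hi
    refine ⟨n, hn, ?_⟩
    rw [entry, hbit, hbit, if_pos (Nat.le_add_right _ _), Nat.add_sub_cancel_left]
    exact hn'

theorem searchLetter_spec {F : ℕ → List (ℕ × ℕ) → PivotTree → (PivotTree → Bool) → Bool}
    {k m n : ℕ} {w : List ℕ} {L : List (ℕ × ℕ)} {T : PivotTree} {f : PivotTree → Bool}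
    (hF : ∀ (n : ℕ) (w : List ℕ) (L : List (ℕ × ℕ)) (T : PivotTree),
      wt (w.map fun m => (m, 0)) + n < k → RowsFrom w 0 L → L.length = 92 →
      T.All (IsCoeffRow k) → F n L T f = true →
      ∃ T' : PivotTree, T'.All (IsCoeffRow k) ∧ f T' = true)
    (hw : wt (w.map fun m => (m, 0)) + (n + 1) < k) (hL : RowsFrom w 0 L) (hlen : L.length = 92)
    (hT : T.All (IsCoeffRow k)) (h : searchLetter F m n L T f = true) :
    ∃ T' : PivotTree, T'.All (IsCoeffRow k) ∧ f T' = true := by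
  rw [searchLetter, Bool.cond_eq_ite] at h
  split_ifs at h with hm
  · have hm : m ≤ n := Nat.le_of_ble_eq_true hm
    obtain ⟨L', A, B, hL', hlen', hAB, h⟩ := consRows_spec (m := m) hL
      (by simpa [intSum] using represents_zero) h
    obtain ⟨c, hc⟩ := exists_intSum_eq (m :: w)
    have hmem : c • biSeries ((m :: w).map fun m => (m, 0)) ∈ biSpan k :=
      Submodule.smul_mem _ _ (biSeries_mem (by simp; omega))
    obtain ⟨T', hT', h⟩ := insertSeries_spec hmem (hAB.congr fun i hi => by
      rw [hc, map_smul, map_smul, coeff_truncSum_of_le _ (by omega)]) hT h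
    exact hF _ (m :: w) L' T' (by simp; omega) hL' (hlen'.trans hlen) hT' h
  · exact ⟨T, hT, h⟩

theorem searchWords_spec {k : ℕ} (d : ℕ) : ∀ {f : PivotTree → Bool} (n : ℕ) (w : List ℕ)
    (L : List (ℕ × ℕ)) (T : PivotTree), wt (w.map fun m => (m, 0)) + n < k → RowsFrom w 0 L →
    L.length = 92 → T.All (IsCoeffRow k) → searchWords d n L T f = true →
    ∃ T' : PivotTree, T'.All (IsCoeffRow k) ∧ f T' = true := by
  induction d with
  | zero => exact fun n w L T _ _ _ hT h => ⟨T, hT, by rwa [searchWords] at h⟩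
  | succ d ih =>
    intro f n w L T hw hL hlen hT h
    rcases n with _ | n
    · exact ⟨T, hT, by rwa [searchWords] at h⟩
    · rw [searchWords] at h
      obtain ⟨T₁, hT₁, h⟩ := searchLetter_spec ih hw hL hlen hT h
      obtain ⟨T₂, hT₂, h⟩ := searchLetter_spec ih hw hL hlen hT₁ h
      exact searchLetter_spec ih hw hL hlen hT₂ h

theorem checkRank_eq_true : checkRank = true := by decide +kernel

theorem rowsFrom_nil (n i : ℕ) : RowsFrom [] i (List.replicate n (1, 0)) := by
  induction n generalizing i with
  | zero => trivial
  | succ n ih => exact ⟨represents_one, ih _⟩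

/-- The `92` pivots give combinations of bi-brackets whose integral coefficients up to `q ^ 92` form
a triangular matrix modulo `3`; there is none for the degree `1`. -/
theorem exists_triangular : ∃ (g : Fin 93 → PowerSeries ℚ) (M : Fin 93 → Fin 93 → ℤ),
    ∀ i, i ≠ 1 → g i ∈ biSpan 8 ∧ (∀ j : Fin 93, coeff (j : ℕ) (g i) = M i j) ∧
      (M i i ≡ 1 [ZMOD 3] ∨ M i i ≡ -1 [ZMOD 3]) ∧ ∀ j, i < j → M i j ≡ 0 [ZMOD 3] := by
  have h := checkRank_eq_true
  have h1 : (1 : PowerSeries ℚ) = biSeries [] := by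
    ext n
    rw [← coeff_truncSum_of_le [] le_rfl]
    rfl
  obtain ⟨T₁, hT₁, h⟩ := insertSeries_spec (k := 8) (T := .empty)
    (h1 ▸ biSeries_mem (by simp)) represents_one trivial h
  obtain ⟨T₂, hT₂, h⟩ := searchWords_spec 7 7 [] _ T₁ (by simp) (rowsFrom_nil 92 0) (by simp) hT₁ h
  have key : ∀ i : Fin 93, ∃ (g : PowerSeries ℚ) (M : Fin 93 → ℤ), i ≠ 1 → g ∈ biSpan 8 ∧
      (∀ j : Fin 93, coeff (j : ℕ) g = M j) ∧
      (M i ≡ 1 [ZMOD 3] ∨ M i ≡ -1 [ZMOD 3]) ∧ ∀ j, i < j → M j ≡ 0 [ZMOD 3] := by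
    intro i
    by_cases hi : i = 1
    · exact ⟨0, 0, fun h => absurd hi h⟩
    have hi' := List.all_eq_true.1 h i (List.mem_range.2 i.2)
    rcases Bool.or_eq_true_iff.1 hi' with hb | hp
    · exact absurd (Fin.ext (Nat.eq_of_beq_eq_true hb)) hi
    rw [force_eq] at hp
    obtain ⟨a, b, ⟨-, g, hg, hc⟩, hone, hlt⟩ := hasPivot_spec And.left hT₂ hp
    choose M hM using fun j : Fin 93 => hc j j.2
    refine ⟨g, M, fun _ => ⟨hg, fun j => (hM j).1, ?_, fun j hj => ?_⟩⟩
    · have h2 := (hM i).2.symm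
      rcases hone with hone | hone <;> rw [show entry a b (64 + i) = _ from hone] at h2
      · exact .inl h2
      · exact .inr h2
    · have h2 := (hM j).2.symm
      rwa [hlt _ (Nat.add_lt_add_left hj 64)] at h2
  choose g M hgM using key
  exact ⟨g, M, hgM⟩

instance finiteDimensional_biSpan (k : ℕ) : FiniteDimensional ℚ (biSpan k) := by
  refine FiniteDimensional.span_of_finite ℚ ?_
  refine ((Set.finite_Iio k).biUnion fun j _ =>
    ((words j).finite_toSet.image biSeries)).subset ?_
  rintro _ ⟨w, hw, rfl⟩
  exact Set.mem_biUnion (Set.mem_Iio.2 hw) ⟨w, mem_words.2 rfl, rfl⟩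

theorem le_finrank_biSpan : 92 ≤ Module.finrank ℚ (biSpan 8) := by
  obtain ⟨g, M, h⟩ := exists_triangular
  let ι := {i : Fin 93 // i ≠ 1}
  let N : Matrix ι ι ℤ := fun i j => M i j
  have hzero : ∀ {a b : ℤ}, a ≡ b [ZMOD 3] → (a : ZMod 3) = b := fun h =>
    (ZMod.intCast_eq_intCast_iff _ _ 3).2 h
  have hdet3 : (N.map (Int.castRingHom (ZMod 3))).det ≠ 0 := by
    rw [Matrix.det_of_isLowerTriangular, Finset.prod_ne_zero_iff]
    · intro i _
      rcases (h i i.2).2.2.1 with h1 | h1 <;> intro h2 <;>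
        rw [Matrix.map_apply, eq_intCast, hzero h1] at h2 <;> revert h2 <;> decide
    · intro i j hij
      have h1 := hzero ((h i i.2).2.2.2 j hij)
      rwa [Int.cast_zero] at h1
  have hdet : (N.map (Int.castRingHom ℚ)).det ≠ 0 := by
    intro h0
    apply hdet3
    rw [← RingHom.mapMatrix_apply, ← RingHom.map_det, eq_intCast, Int.cast_eq_zero] at h0
    rw [← RingHom.mapMatrix_apply, ← RingHom.map_det, h0, map_zero]
  have hind : LinearIndependent ℚ fun i : ι => (⟨g i, (h i i.2).1⟩ : biSpan 8) := by
    let φ : biSpan 8 →ₗ[ℚ] ι → ℚ :=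
      (LinearMap.pi fun j : ι => coeff (j : Fin 93).val) ∘ₗ (biSpan 8).subtype
    refine LinearIndependent.of_comp φ ?_
    have hφ : (φ ∘ fun i : ι => (⟨g i, (h i i.2).1⟩ : biSpan 8)) =
        (N.map (Int.castRingHom ℚ)).row := by
      ext i j
      exact (h i i.2).2.1 j
    rw [hφ]
    exact Matrix.linearIndependent_rows_of_det_ne_zero hdet
  have := hind.fintype_card_le_finrank
  simpa [ι] using this

/-! ### Brackets with entries at most three as values of `ζ_q` -/

/-- The polynomial `Q` with `∑ v ^ m / m! * q ^ v = Q(q) / (1 - q) ^ (m + 1)`, for `m ≤ 2`. -/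
def eulerPoly : ℕ → Polynomial ℚ
  | 0 => .X
  | 1 => .X
  | _ => .C (1 / 2) * (.X + .X ^ 2)

theorem coeff_zero_eulerPoly (m : ℕ) : (eulerPoly m).coeff 0 = 0 := by
  rcases m with _ | _ | m <;> simp [eulerPoly]

theorem natDegree_eulerPoly_le {m : ℕ} : (eulerPoly m).natDegree ≤ m + 1 := by
  rcases m with _ | _ | m
  · simp [eulerPoly]
  · simp [eulerPoly]
  · refine (Polynomial.natDegree_C_mul_le _ _).trans ?_
    refine (Polynomial.natDegree_add_le _ _).trans ?_
    simp

theorem powSeries_mul_one_sub_pow {m : ℕ} (hm : m ≤ 2) :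
    powSeries m * (1 - X) ^ (m + 1) = Polynomial.aeval (X : PowerSeries ℚ) (eulerPoly m) := by
  have h0 := powSeries_zero_mul_one_sub
  have h1 := powSeries_zero_mul_self
  interval_cases m
  · simpa [eulerPoly] using h0
  · simp only [eulerPoly, Polynomial.aeval_X]
    linear_combination (X + (1 - X) + powSeries 0 * (1 - X)) * h0 - (1 - X) ^ 2 * h1
  · have h2 := congrArg eulerDeriv h1
    have hsub : eulerDeriv (powSeries 1 - powSeries 0) =
        eulerDeriv (powSeries 1) - eulerDeriv (powSeries 0) := by
      simp [eulerDeriv, mul_sub]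
    rw [hsub, eulerDeriv_mul, eulerDeriv_powSeries, eulerDeriv_powSeries] at h2
    have h3 : powSeries 2 = powSeries 0 * powSeries 1 + (C (1 / 2 : ℚ)) * powSeries 1 := by
      have h4 : (2 : ℚ) • powSeries 2 = 2 * (powSeries 0 * powSeries 1) + powSeries 1 := by
        norm_num at h2
        linear_combination -h2
      rw [← one_smul ℚ (powSeries 2), show (1 : ℚ) = 1 / 2 * 2 by norm_num, mul_smul, h4,
        smul_add, smul_eq_C_mul, smul_eq_C_mul, ← mul_assoc, ← map_ofNat C 2, ← map_mul]
      norm_num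
    have h5 : (C (1 / 2 : ℚ)) * 2 = 1 := by
      rw [← map_ofNat C 2, ← map_mul]; norm_num
    have h6 : powSeries 1 * (1 - X) ^ 2 = X := by
      linear_combination (X + (1 - X) + powSeries 0 * (1 - X)) * h0 - (1 - X) ^ 2 * h1
    have h7 : Polynomial.aeval (X : PowerSeries ℚ) (eulerPoly 2) = C (1 / 2 : ℚ) * (X + X ^ 2) := by
      simp [eulerPoly]
    rw [h7, h3]
    linear_combination (powSeries 0 * (1 - X) + C (1 / 2 : ℚ) * (1 - X)) * h6 + X * h0 - X ^ 2 * h5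

theorem dilate_eq {m : ℕ} (hm : m ≤ 2) (i : ℕ) : dilate m i =
    Polynomial.aeval ((X : PowerSeries ℚ) ^ (i + 1)) (eulerPoly m) *
      (((1 : PowerSeries ℚ) - X ^ (i + 1))⁻¹) ^ (m + 1) := by
  have h1 := congrArg (expand (i + 1) i.succ_ne_zero) (powSeries_mul_one_sub_pow hm)
  rw [map_mul, map_pow, map_sub, map_one, expand_X, ← Polynomial.aeval_algHom_apply, expand_X] at h1
  have h2 : ((1 : PowerSeries ℚ) - X ^ (i + 1)) * (1 - X ^ (i + 1))⁻¹ = 1 :=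
    PowerSeries.mul_inv_cancel _ (by simp)
  rw [← h1, dilate, mul_assoc, ← mul_pow, h2, one_pow, mul_one]

/-- For `s ≤ 3` and `r = 0`, the truncations of a bi-bracket are those of a series `ζ_q`. -/
theorem sum_decTuples (w : Word) (hw : ∀ x ∈ w, x.1 ≤ 2 ∧ x.2 = 0) (N : ℕ) :
    ∑ n ∈ decTuples w.length N, zetaTerm (fun j : Fin w.length => (w.get j).1 + 1)
      (fun j => eulerPoly (w.get j).1) n = truncSum w N := by
  induction w generalizing N with
  | nil =>
    rw [Finset.sum_eq_single default]
    · simp [zetaTerm, truncSum]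
    · intro n _ hn
      exact absurd (funext fun j => j.elim0) hn
    · intro h
      refine absurd ?_ h
      simp only [decTuples, Finset.mem_filter, Fintype.mem_piFinset]
      exact ⟨fun j => j.elim0, fun j => j.elim0, fun j => j.elim0⟩
  | cons x w ih =>
    obtain ⟨hm, hr⟩ := hw x List.mem_cons_self
    have ih := ih fun x hx => hw x (List.mem_cons_of_mem _ hx)
    have hmem : ∀ {l N : ℕ} {n : Fin l → ℕ}, n ∈ decTuples l N ↔
        (∀ j, n j ≤ N) ∧ StrictAnti n ∧ ∀ j, 0 < n j := by
      intro l N n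
      simp [decTuples]
    rw [truncSum, consSum_apply]
    have h1 : ∀ i ∈ Finset.range N, (((i + 1 : ℕ) : ℚ) ^ x.2 / x.2.factorial) •
        (dilate x.1 i * truncSum w i) = ∑ n ∈ decTuples w.length i, dilate x.1 i *
          zetaTerm (fun j : Fin w.length => (w.get j).1 + 1)
            (fun j => eulerPoly (w.get j).1) n := by
      intro i _
      rw [← Finset.mul_sum, ih, hr]
      simp
    rw [Finset.sum_congr rfl h1, Finset.sum_sigma']
    refine Finset.sum_bij' (fun n _ => ⟨n 0 - 1, fun j : Fin w.length => n j.succ⟩)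
      (fun t _ => (Fin.cons (t.1 + 1) t.2 : Fin (w.length + 1) → ℕ)) ?_ ?_ ?_ ?_ ?_
    · intro n hn
      obtain ⟨hN, ha, h0⟩ := hmem.1 hn
      obtain ⟨ha1, ha2⟩ := (strictAnti_fin_succ n).1 ha
      have hN0 := hN 0
      have h00 := h0 0
      rw [Finset.mem_sigma, Finset.mem_range, hmem]
      exact ⟨by change n 0 - 1 < N; omega, fun j => Nat.le_sub_one_of_lt (ha1 j), ha2,
        fun j => h0 _⟩
    · rintro ⟨i, n⟩ ht
      rw [Finset.mem_sigma, Finset.mem_range, hmem] at ht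
      obtain ⟨hi, hN, ha, h0⟩ := ht
      refine hmem.2 ⟨Fin.cases hi fun j => (hN j).trans hi.le,
        (strictAnti_fin_succ _).2 ⟨fun j => Nat.lt_succ_of_le (hN j), ha⟩, Fin.cases i.succ_pos h0⟩
    · intro n hn
      have h0 := (hmem.1 hn).2.2 0
      refine funext (Fin.cases (Nat.sub_add_cancel h0) fun j => rfl)
    · rintro ⟨i, n⟩ _
      rfl
    · intro n hn
      have h0 := (hmem.1 hn).2.2 0
      refine (Fin.prod_univ_succ (n := w.length) _).trans ?_
      rw [dilate_eq hm, Nat.sub_add_cancel h0]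
      rfl

theorem biSeries_mem_ZqCirc {w : Word} (hw : ∀ x ∈ w, x.1 ≤ 2 ∧ x.2 = 0) :
    biSeries w ∈ ZqCirc := by
  refine Submodule.subset_span ⟨w.length, fun j => (w.get j).1 + 1,
    fun j => eulerPoly (w.get j).1, fun j => Nat.succ_pos _, fun j => natDegree_eulerPoly_le,
    fun j => coeff_zero_eulerPoly _, ?_⟩
  ext N
  rw [zetaQ, coeff_mk, ← map_sum, sum_decTuples w hw, coeff_truncSum_of_le w le_rfl]

theorem ZqCirc_le_Zq : ZqCirc ≤ Zq :=
  Submodule.span_mono fun _ ⟨l, s, Q, hs, hd, hQ, hf⟩ => ⟨l, s, Q, hs, hd, fun j _ => hQ j, hf⟩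

/-! ### The weight filtration -/

theorem weight_word (w : Word) :
    weight (fun j : Fin w.length => (w.get j).1 + 1) (fun j => (w.get j).2) = wt w := by
  induction w with
  | nil => rfl
  | cons x w ih =>
    rw [wt_cons, ← ih, weight, weight]
    refine (congrArg₂ (· + ·) (Fin.sum_univ_succ (n := w.length) _)
      (Fin.sum_univ_succ (n := w.length) _)).trans ?_
    simp only [List.get_eq_getElem, List.length_cons, Fin.val_zero, List.getElem_cons_zero,
      Fin.val_succ, List.getElem_cons_succ]
    ring

theorem length_le_wt (w : Word) : w.length ≤ wt w := by
  induction w with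
  | nil => rfl
  | cons x w ih => simp; omega

theorem exists_word {l : ℕ} {s : Fin l → ℕ} (r : Fin l → ℕ) (hs : ∀ j, 1 ≤ s j) :
    ∃ w : Word, wt w = weight s r ∧ biSeries w = biBracket s r := by
  have key : ∀ (w : Word) (h : w.length = l), (∀ j, w.get (Fin.cast h.symm j) = (s j - 1, r j)) →
      wt w = weight s r ∧ biSeries w = biBracket s r := by
    rintro w rfl hw
    have h1 : (fun j => (w.get j).1 + 1) = s := funext fun j => by
      rw [show w.get j = _ from hw j]; exact Nat.sub_add_cancel (hs j)
    have h2 : (fun j => (w.get j).2) = r := funext fun j => by rw [show w.get j = _ from hw j]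
    exact ⟨by rw [← weight_word, h1, h2], by rw [biSeries, h1, h2]⟩
  exact ⟨_, key (List.ofFn fun j => (s j - 1, r j)) (List.length_ofFn) fun j => by simp⟩

theorem filW_le_biSpan (A : Set (PowerSeries ℚ)) (k : ℕ) : filW A ((k : ℤ) - 1) ≤ biSpan k := by
  refine Submodule.span_le.2 ?_
  rintro _ ⟨-, l, s, r, hs, -, hk, rfl⟩
  obtain ⟨w, hw, h⟩ := exists_word r hs
  rw [← h]
  exact biSeries_mem (by omega)

theorem le_two_of_isBasic {w : Word} (h : isBasic w = true) {x : ℕ × ℕ} (hx : x ∈ w) :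
    x.1 ≤ 2 ∧ x.2 = 0 := by
  have h1 := List.all_eq_true.1 (Bool.and_eq_true_iff.1 h).1 x hx
  exact ⟨Nat.le_of_ble_eq_true (Bool.and_eq_true_iff.1 h1).1,
    Nat.eq_of_beq_eq_true (Bool.and_eq_true_iff.1 h1).2⟩

theorem biSpan_mono {j k : ℕ} (h : j ≤ k) : biSpan j ≤ biSpan k :=
  Submodule.span_mono fun _ ⟨w, hw, hf⟩ => ⟨w, hw.trans_le h, hf⟩

theorem biSpan_succ_le {k : ℕ} (hk : k ≤ 7) : biSpan (k + 1) ≤ biSpan k ⊔ basicSpan k := by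
  refine Submodule.span_le.2 ?_
  rintro _ ⟨w, hw, rfl⟩
  rcases Nat.lt_succ_iff_lt_or_eq.1 hw with hw | hw
  · exact Submodule.mem_sup_left (biSeries_mem hw)
  · exact biSeries_mem_of_check (check_eq_true hk) hw

theorem biSpan_zero : biSpan 0 = ⊥ :=
  Submodule.span_eq_bot.2 fun _ ⟨_, hw, _⟩ => absurd hw (Nat.not_lt_zero _)

/-- Whatever contains the brackets of all basic words contains all bi-brackets, by induction on the
weight. -/
theorem biSpan_succ_le_of_basicSpan_le {S : ℕ → Submodule ℚ (PowerSeries ℚ)} (hS : Monotone S)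
    (hbasic : ∀ k, basicSpan k ≤ S k) {k : ℕ} (hk : k ≤ 7) : biSpan (k + 1) ≤ S k := by
  induction k with
  | zero => exact (biSpan_succ_le hk).trans (sup_le (biSpan_zero ▸ bot_le) (hbasic 0))
  | succ k ih =>
    exact (biSpan_succ_le hk).trans
      (sup_le ((ih (Nat.le_of_succ_le hk)).trans (hS k.le_succ)) (hbasic _))

theorem biSpan_succ_le_filW {k : ℕ} (hk : k ≤ 7) :
    biSpan (k + 1) ≤ filW (ZqCirc : Set (PowerSeries ℚ)) k := by
  refine biSpan_succ_le_of_basicSpan_le (S := fun k : ℕ => filW (ZqCirc : Set (PowerSeries ℚ)) k)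
    (fun i j hij => Submodule.span_mono ?_) (fun k => Submodule.span_le.2 ?_) hk
  · rintro _ ⟨hf, l, s, r, hs, hl, hk, rfl⟩
    exact ⟨hf, l, s, r, hs, by omega, by omega, rfl⟩
  · rintro _ ⟨w, hw, hb, rfl⟩
    refine Submodule.subset_span ⟨biSeries_mem_ZqCirc fun x hx => le_two_of_isBasic hb hx,
      w.length, fun j => (w.get j).1 + 1, fun j => (w.get j).2, fun j => Nat.succ_pos _,
      ?_, ?_, rfl⟩
    · have := length_le_wt w
      omega
    · rw [weight_word]
      omega

theorem filW_eq {k : ℕ} (hk : k ≤ 7) :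
    filW (ZqCirc : Set (PowerSeries ℚ)) k = biSpan (k + 1) ∧
      filW (Zq : Set (PowerSeries ℚ)) k = biSpan (k + 1) := by
  have hle := biSpan_succ_le_filW hk
  have h : ∀ A, filW A k ≤ biSpan (k + 1) := fun A => by simpa using filW_le_biSpan A (k + 1)
  refine ⟨le_antisymm (h _) hle, le_antisymm (h _) (hle.trans (Submodule.span_mono ?_))⟩
  rintro f ⟨hf, h⟩
  exact ⟨ZqCirc_le_Zq hf, h⟩

theorem filW_sub_one_eq {k : ℕ} (hk : k ≤ 7) :
    filW (Zq : Set (PowerSeries ℚ)) ((k : ℤ) - 1) = biSpan k := by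
  rcases k with _ | k
  · rw [biSpan_zero, eq_bot_iff, ← biSpan_zero]
    exact filW_le_biSpan _ 0
  · rw [← (filW_eq (Nat.le_of_succ_le hk)).2]
    simp

theorem bracketSpan123_mono : Monotone bracketSpan123 := fun _ _ h =>
  Submodule.span_mono fun _ ⟨l, s, hs, hk, hf⟩ => ⟨l, s, hs, hk.trans h, hf⟩

theorem basicSpan_le (k : ℕ) : basicSpan k ≤ bracketSpan123 k := by
  refine Submodule.span_le.2 ?_
  rintro _ ⟨w, hw, hb, rfl⟩
  have hr : (fun j : Fin w.length => (w.get j).2) = fun _ => 0 :=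
    funext fun j => (le_two_of_isBasic hb (List.get_mem w j)).2
  refine Submodule.subset_span ⟨w.length, fun j => (w.get j).1 + 1, fun j => ?_, ?_, ?_⟩
  · have := (le_two_of_isBasic hb (List.get_mem w j)).1
    change (w.get j).1 + 1 = 1 ∨ (w.get j).1 + 1 = 2 ∨ (w.get j).1 + 1 = 3
    omega
  · rw [← hw, ← weight_word, weight]
    exact Nat.le_add_right _ _
  · rw [biSeries, hr]
    rfl

theorem bracketSpan123_le (k : ℕ) : bracketSpan123 k ≤ bracketSpan k :=
  Submodule.span_mono fun _ ⟨l, s, hs, hk, hf⟩ => ⟨l, s, fun j => by have := hs j; omega, hk, hf⟩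

theorem bracketSpan_le (k : ℕ) : bracketSpan k ≤ positiveSpan k :=
  Submodule.span_mono fun _ ⟨l, s, hs, hk, hf⟩ =>
    ⟨l, s, fun _ => 0, hs, by simpa [weight] using hk, hf⟩

/-! ### Dimensions -/

/-- The coefficients of `1 / (1 - x - x ^ 2 - x ^ 3 + x ^ 6 + x ^ 7 + x ^ 8 + x ^ 9)`. -/
def gradedDim : ℕ → ℕ
  | 0 => 1
  | 1 => 1
  | 2 => 2
  | 3 => 4
  | 4 => 7
  | 5 => 13
  | 6 => 23
  | _ => 41

theorem length_filter_isBasic {k : ℕ} (hk : k ≤ 7) :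
    ((words k).filter isBasic).length = gradedDim k := by
  revert k
  decide +kernel

theorem finrank_biSpan_succ_le {k : ℕ} (hk : k ≤ 7) :
    Module.finrank ℚ (biSpan (k + 1)) ≤ Module.finrank ℚ (biSpan k) + gradedDim k := by
  classical
  let s : Finset (PowerSeries ℚ) := (((words k).filter isBasic).map biSeries).toFinset
  have hs : basicSpan k = Submodule.span ℚ (s : Set (PowerSeries ℚ)) := by
    refine congrArg _ (Set.ext fun f => ?_)
    simp only [s, Set.mem_ofPred_eq, List.coe_toFinset, List.mem_map, List.mem_filter, mem_words]
    exact ⟨fun ⟨w, h1, h2, h3⟩ => ⟨w, ⟨h1, h2⟩, h3.symm⟩,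
      fun ⟨w, ⟨h1, h2⟩, h3⟩ => ⟨w, h1, h2, h3.symm⟩⟩
  have hcard : Module.finrank ℚ (basicSpan k) ≤ gradedDim k := by
    rw [hs, ← length_filter_isBasic hk]
    refine (finrank_span_finset_le_card s).trans ((List.toFinset_card_le _).trans ?_)
    rw [List.length_map]
  have : FiniteDimensional ℚ (basicSpan k) := by rw [hs]; infer_instance
  calc Module.finrank ℚ (biSpan (k + 1)) ≤ Module.finrank ℚ ↥(biSpan k ⊔ basicSpan k) :=
        Submodule.finrank_mono (biSpan_succ_le hk)
    _ ≤ Module.finrank ℚ (biSpan k) + Module.finrank ℚ (basicSpan k) :=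
        Submodule.finrank_add_le_finrank_add_finrank _ _
    _ ≤ _ := Nat.add_le_add_left hcard _

/-- The upper bounds for the steps of the filtration add up to the lower bound `92`, so all of them
are equalities. -/
theorem finrank_biSpan_succ {k : ℕ} (hk : k ≤ 7) :
    Module.finrank ℚ (biSpan (k + 1)) = Module.finrank ℚ (biSpan k) + gradedDim k := by
  have h0 := finrank_biSpan_succ_le (k := 0) (by norm_num)
  have h1 := finrank_biSpan_succ_le (k := 1) (by norm_num)
  have h2 := finrank_biSpan_succ_le (k := 2) (by norm_num)
  have h3 := finrank_biSpan_succ_le (k := 3) (by norm_num)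
  have h4 := finrank_biSpan_succ_le (k := 4) (by norm_num)
  have h5 := finrank_biSpan_succ_le (k := 5) (by norm_num)
  have h6 := finrank_biSpan_succ_le (k := 6) (by norm_num)
  have h7 := finrank_biSpan_succ_le (k := 7) (by norm_num)
  have h8 := le_finrank_biSpan
  have hz : Module.finrank ℚ (biSpan 0) = 0 := by rw [biSpan_zero, finrank_bot]
  simp only [gradedDim, Nat.reduceAdd] at h0 h1 h2 h3 h4 h5 h6 h7
  interval_cases k <;> simp only [gradedDim, Nat.reduceAdd] <;> omega

theorem finrank_grW {k : ℕ} (hk : k ≤ 7) :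
    Module.finrank ℚ (grW (Zq : Set (PowerSeries ℚ)) k) = gradedDim k := by
  have key : ∀ {P N : Submodule ℚ (PowerSeries ℚ)}, P = biSpan (k + 1) → N = biSpan k →
      Module.finrank ℚ (P ⧸ N.submoduleOf P) = gradedDim k := by
    rintro _ _ rfl rfl
    have h1 := Submodule.finrank_quotient_add_finrank ((biSpan k).submoduleOf (biSpan (k + 1)))
    rw [(Submodule.submoduleOfEquivOfLe (biSpan_mono k.le_succ)).finrank_eq,
      finrank_biSpan_succ hk] at h1
    omega
  exact key (filW_eq hk).2 (filW_sub_one_eq hk)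

theorem coeff_inv_eq {k : ℕ} (hk : k ≤ 7) : coeff k
    ((1 - X - X ^ 2 - X ^ 3 + X ^ 6 + X ^ 7 + X ^ 8 + X ^ 9 : PowerSeries ℚ)⁻¹) = gradedDim k := by
  have hinv := PowerSeries.mul_inv_cancel
    (1 - X - X ^ 2 - X ^ 3 + X ^ 6 + X ^ 7 + X ^ 8 + X ^ 9 : PowerSeries ℚ) (by simp)
  generalize (1 - X - X ^ 2 - X ^ 3 + X ^ 6 + X ^ 7 + X ^ 8 + X ^ 9 : PowerSeries ℚ)⁻¹ = f at *
  obtain ⟨R, hR⟩ : ∃ R, f = 1 + X + 2 * X ^ 2 + 4 * X ^ 3 + 7 * X ^ 4 + 13 * X ^ 5 + 23 * X ^ 6 +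
      41 * X ^ 7 + X ^ 8 * R := by
    refine ⟨(73 + 56 * X + 27 * X ^ 2 - 26 * X ^ 3 - 47 * X ^ 4 - 84 * X ^ 5 - 77 * X ^ 6 -
      64 * X ^ 7 - 41 * X ^ 8) * f, ?_⟩
    linear_combination (1 + X + 2 * X ^ 2 + 4 * X ^ 3 + 7 * X ^ 4 + 13 * X ^ 5 + 23 * X ^ 6 +
      41 * X ^ 7) * hinv
  rw [hR, map_add, coeff_X_pow_mul', if_neg (by omega), add_zero]
  simp only [← map_ofNat (C (R := ℚ)), map_add, coeff_C_mul, coeff_X_pow, coeff_X, coeff_one]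
  interval_cases k <;> norm_num [gradedDim]

end

end QMZV

theorem theorem3p3 (k : ℕ) (hk : k ≤ 7) :
    (Module.finrank ℚ (QMZV.grW (QMZV.Zq : Set (PowerSeries ℚ)) k) : ℚ) =
      PowerSeries.coeff k
        ((1 - PowerSeries.X - PowerSeries.X ^ 2 - PowerSeries.X ^ 3 + PowerSeries.X ^ 6 +
          PowerSeries.X ^ 7 + PowerSeries.X ^ 8 + PowerSeries.X ^ 9 : PowerSeries ℚ)⁻¹) ∧
    (∀ (l : ℕ) (s r : Fin l → ℕ), (∀ j, 1 ≤ s j) → QMZV.weight s r = k →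
      QMZV.biBracket s r ∈ QMZV.positiveSpan k ∧
      QMZV.biBracket s r ∈ QMZV.bracketSpan k ∧
      QMZV.biBracket s r ∈ QMZV.bracketSpan123 k) ∧
    QMZV.filW (QMZV.ZqCirc : Set (PowerSeries ℚ)) k =
      QMZV.filW (QMZV.Zq : Set (PowerSeries ℚ)) k := by
  refine ⟨?_, fun l s r hs hw => ?_, ?_⟩
  · rw [QMZV.finrank_grW hk, QMZV.coeff_inv_eq hk]
  · obtain ⟨w, hw', h⟩ := QMZV.exists_word r hs
    have h123 : QMZV.biBracket s r ∈ QMZV.bracketSpan123 k := by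
      rw [← h]
      exact QMZV.biSpan_succ_le_of_basicSpan_le QMZV.bracketSpan123_mono QMZV.basicSpan_le hk
        (QMZV.biSeries_mem (by omega))
    exact ⟨QMZV.bracketSpan_le k (QMZV.bracketSpan123_le k h123),
      QMZV.bracketSpan123_le k h123, h123⟩
  · rw [(QMZV.filW_eq hk).1, (QMZV.filW_eq hk).2]
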